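/- Let $G$ be a finite simple graph. For a finite simple graph $H$ put $f(H)=2|V(H)|-|E(H)|$. Call $G$ $(2,1)$-tight if $f(G)=1$ and $f(H)\ge 1$ for every subgraph $H$ of $G$ with at least one edge. Let $K_5\setminus e$ be the complete graph on five vertices with one edge removed, and let $K_4\sqcup K_4$ be the union of two copies of $K_4$ that intersect in exactly one edge together with its two end-vertices (so it has $6$ vertices and $11$ edges). Then the following are equivalent: (1) $G$ is $(2,1)$-tight; (2) $G$ can be derived, up to isomorphism, from copies of $K_5\setminus e$ and $K_4\sqcup K_4$ by finitely many applications of the following moves, all of which produce simple graphs: - Henneberg 1: add a new vertex joined to exactly two distinct existing vertices; - Henneberg 2: remove an edge $uv$ and add a new vertex $x$ together with the edges $xu,xv,xw$ for some vertex $w\ne u,v$; - vertex-to-$K_4$: replace a vertex $v$ by a copy of $K_4$ and replace each edge $av$ by one edge from $a$ to some vertex of this $K_4$; - edge-to-$K_3$: for an edge $uv$, replace the vertex $v$ by two vertices $v_1,v_2$, with the edges $uv_1,uv_2,v_1v_2$, and replace each remaining edge $av$ ($a\neq u$) by exactly one of $av_1$, $av_2$ (possibly the same choice for all $a$); - edge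 joining: from two already derived graphs $K$ and $H$, taken vertex-disjoint, and vertices $u\in V(K)$, $v\in V(H)$, form the graph with vertex set $V(K)\cup V(H)$ and edge set $E(K)\cup E(H)\cup\{uv\}$; (3) $G$ is the edge-disjoint union of a spanning tree $T$ and a spanning subgraph $P$ in which every connected component contains exactly one cycle. -/

import Mathlib

universe u

namespace TightGraph

/-! ### Sparsity and tightness -/

/-- `f(H) = 2|V(H)| - |E(H)|` for a subgraph `H` of a (finite) simple graph. -/
noncomputable def freedom {V : Type u} {G : SimpleGraph V} (H : G.Subgraph) : ℤ :=
  2 * (H.verts.ncard : ℤ) - (H.edgeSet.ncard : ℤ)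

/-- `(2,ℓ)`-sparse: `f(H) ≥ ℓ` for all subgraphs `H` with at least one edge. -/
def IsSparse {V : Type u} (ℓ : ℕ) (G : SimpleGraph V) : Prop :=
  ∀ H : G.Subgraph, H.edgeSet.Nonempty → (ℓ : ℤ) ≤ freedom H

/-- `(2,ℓ)`-tight: `(2,ℓ)`-sparse and `f(G) = ℓ`. -/
def IsTight {V : Type u} (ℓ : ℕ) (G : SimpleGraph V) : Prop :=
  IsSparse ℓ G ∧ freedom (⊤ : G.Subgraph) = (ℓ : ℤ)

/-! ### The two starting graphs -/

/-- `K₅ ∖ e`. -/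
def K5MinusEdge : SimpleGraph (Fin 5) :=
  (⊤ : SimpleGraph (Fin 5)).deleteEdges {s(0, 1)}

/-- `K₄ ⊔ K₄`: the two copies of `K₄` on `{0,1,2,3}` and `{2,3,4,5}`, which intersect in the
complete graph on `{2,3}`. -/
def twoK4 : SimpleGraph (Fin 6) where
  Adj i j := i ≠ j ∧ ((i ≤ 3 ∧ j ≤ 3) ∨ (2 ≤ i ∧ 2 ≤ j))
  symm := ⟨by rintro i j ⟨h, h' | h'⟩
              · exact ⟨h.symm, Or.inl h'.symm⟩
              · exact ⟨h.symm, Or.inr h'.symm⟩⟩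
  loopless := ⟨fun _ h => h.1 rfl⟩

/-! ### The moves -/

/-- Add to `G` a new vertex (`none`) whose neighbours are exactly the members of `S`. -/
def addVertex {V : Type u} (G : SimpleGraph V) (S : Set V) : SimpleGraph (Option V) where
  Adj
    | some a, some b => G.Adj a b
    | some a, none => a ∈ S
    | none, some b => b ∈ S
    | none, none => False
  symm := ⟨by rintro (_ | a) (_ | b) h
              · exact h
              · exact h
              · exact h
              · exact G.adj_symm h⟩
  loopless := ⟨by rintro (_ | a) h
                  · exact h
                  · exact G.irrefl h⟩

/-- Henneberg 1 move (for `a ≠ b`): add a vertex of degree two with neighbours `a`, `b`. -/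
def henneberg1 {V : Type u} (G : SimpleGraph V) (a b : V) : SimpleGraph (Option V) :=
  addVertex G {a, b}

/-- Henneberg 2 move (for an edge `ab` and a vertex `c` other than `a`, `b`): remove the edge `ab`
and add a vertex with neighbours `a`, `b`, `c`. -/
def henneberg2 {V : Type u} (G : SimpleGraph V) (a b c : V) : SimpleGraph (Option V) :=
  addVertex (G.deleteEdges {s(a, b)}) {a, b, c}

/-- Replace the vertex `v` of `G` by a complete graph on `ι`; a vertex `a ≠ v` is joined to the new
vertex `i` exactly when `R a i` holds. -/
def replaceVertex {V : Type u} (G : SimpleGraph V) (v : V) (ι : Type) (R : V → ι → Prop) :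
    SimpleGraph ({a : V // a ≠ v} ⊕ ι) where
  Adj
    | Sum.inl a, Sum.inl b => G.Adj a b
    | Sum.inl a, Sum.inr i => R a i
    | Sum.inr i, Sum.inl a => R a i
    | Sum.inr i, Sum.inr j => i ≠ j
  symm := ⟨by rintro (a | i) (b | j) h
              · exact G.adj_symm h
              · exact h
              · exact h
              · exact Ne.symm h⟩
  loopless := ⟨by rintro (a | i) h
                  · exact G.irrefl h
                  · exact h rfl⟩

/-- Vertex-to-`K₄` move: replace `v` by a `K₄`; each edge `av` becomes the edge from `a` to the
vertex `φ a` of the `K₄`. -/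
def vertexToK4 {V : Type u} (G : SimpleGraph V) (v : V) (φ : V → Fin 4) :
    SimpleGraph ({a : V // a ≠ v} ⊕ Fin 4) :=
  replaceVertex G v (Fin 4) fun a i => G.Adj a v ∧ φ a = i

/-- Edge-to-`K₃` move on an edge `uv`: replace `v` by two adjacent vertices, both adjacent to `u`;
each of the remaining edges `av` becomes the edge from `a` to the new vertex `φ a`. -/
def edgeToK3 {V : Type u} (G : SimpleGraph V) (u v : V) (φ : V → Fin 2) :
    SimpleGraph ({a : V // a ≠ v} ⊕ Fin 2) :=
  replaceVertex G v (Fin 2) fun a i => a = u ∨ (G.Adj a v ∧ φ a = i)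

/-- Edge joining move: the disjoint union of `K` and `H` with the edge `uv` added. -/
def edgeJoin {V W : Type u} (K : SimpleGraph V) (H : SimpleGraph W) (u : V) (v : W) :
    SimpleGraph (V ⊕ W) :=
  (K ⊕g H) ⊔ SimpleGraph.edge (Sum.inl u) (Sum.inr v)

/-- The graphs that can be derived, up to isomorphism, from `K₅ ∖ e` or `K₄ ⊔ K₄` by the
Henneberg 1, Henneberg 2, vertex-to-`K₄`, edge joining and edge-to-`K₃` moves. -/
inductive Derivable : ∀ {V : Type u}, SimpleGraph V → Prop
  | base_K5MinusEdge {V : Type u} (G : SimpleGraph V) (e : K5MinusEdge ≃g G) : Derivable G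
  | base_twoK4 {V : Type u} (G : SimpleGraph V) (e : twoK4 ≃g G) : Derivable G
  | iso {V W : Type u} (G : SimpleGraph V) (G' : SimpleGraph W) (e : G ≃g G') :
      Derivable G → Derivable G'
  | henneberg1 {V : Type u} (G : SimpleGraph V) (a b : V) (hab : a ≠ b) :
      Derivable G → Derivable (TightGraph.henneberg1 G a b)
  | henneberg2 {V : Type u} (G : SimpleGraph V) (a b c : V) (hab : G.Adj a b)
      (hca : c ≠ a) (hcb : c ≠ b) :
      Derivable G → Derivable (TightGraph.henneberg2 G a b c)
  | vertexToK4 {V : Type u} (G : SimpleGraph V) (v : V) (φ : V → Fin 4) :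
      Derivable G → Derivable (TightGraph.vertexToK4 G v φ)
  | edgeToK3 {V : Type u} (G : SimpleGraph V) (u v : V) (huv : G.Adj u v) (φ : V → Fin 2) :
      Derivable G → Derivable (TightGraph.edgeToK3 G u v φ)
  | edgeJoin {V W : Type u} (K : SimpleGraph V) (H : SimpleGraph W) (u : V) (v : W) :
      Derivable K → Derivable H → Derivable (TightGraph.edgeJoin K H u v)

/-! ### Decomposition into a spanning tree and a spanning subgraph with unicyclic components -/

/-- The subgraph `C` is a cycle of `P`. -/
def IsCycleSubgraph {V : Type u} {P : SimpleGraph V} (C : P.Subgraph) : Prop :=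
  ∃ (v : V) (p : P.Walk v v), p.IsCycle ∧ p.toSubgraph = C

/-- Every connected component of `P` contains exactly one cycle (cycles being counted as
subgraphs). -/
def ComponentsUnicyclic {V : Type u} (P : SimpleGraph V) : Prop :=
  ∀ c : P.ConnectedComponent, ∃! C : P.Subgraph, IsCycleSubgraph C ∧ C.verts ⊆ c.supp

/-- `G` is the edge-disjoint union of a spanning tree `T` and a spanning subgraph `P` in which every
connected component contains exactly one cycle. A graph on the vertex type of `G` is spanning. -/
def HasTreeUnicyclicDecomposition {V : Type u} (G : SimpleGraph V) : Prop :=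
  ∃ T P : SimpleGraph V, T ⊔ P = G ∧ Disjoint T.edgeSet P.edgeSet ∧ T.IsTree ∧
    ComponentsUnicyclic P

end TightGraph

/-! On a given vertex set the induced subgraph has the least freedom, so tightness is a statement
about `frd`, the function 2|S| - |E(S)| on vertex sets. This function is submodular. If S and S' are
tight (`frd` at most 1) and meet, then so are their union and intersection; this uncrossing drives
(1) → (2).

(1) → (2) is an induction on the number of vertices in which the moves are inverted. If no inverse
of a Henneberg or contraction move applies, then all degrees are at least 3 and each failed
inversion leaves a tight set blocking it. Uncrossing the blocking sets around a vertex of degree 3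
makes its neighbourhood a triangle (`adj_of_nonadjacent_pairs_blocked`), so the vertex lies in a
`K₄`. Growing this `K₄` by vertices attached along edges, the blocked contractions stop the growth
after at most one step and produce one of the two starting graphs
(`exists_extension_of_isNClique_four`). These copies are minimal tight sets, hence disjoint. Since
the sum of 4 - deg over all vertices is 2, and a copy with b boundary edges contributes 2 - b, some
copy has b ≤ 1 (`exists_isBaseSet_boundary_le_one`). Then G is that copy or an edge joining of it to
a smaller tight graph.

(2) → (3): a finite graph has unicyclic components exactly when it can be oriented with all
out-degrees one. The decomposition is therefore encoded by an out-neighbour map `o` for P, and by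
connectivity together with a parent map `t` towards a root for T. The map `t` only has to cover the
tree edges, which bounds their number by |V| - 1; its other values are free. In this form every move
changes the data locally.

(3) → (1): a nonempty S spans at most |S| - 1 edges of T and at most |S| edges of P, with equality
for S = V. -/

namespace TightGraph

/-! ### Edge counts on vertex sets and submodularity -/

section Counting

open Finset Classical

variable {V : Type u} {G : SimpleGraph V}

/-- The edges of `G` with both ends in `S`. -/
noncomputable def edgesIn (G : SimpleGraph V) (S : Finset V) : Finset (Sym2 V) :=
  S.sym2.filter (· ∈ G.edgeSet)

/-- The neighbours of `x` in `S`. -/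
noncomputable def nbrs (G : SimpleGraph V) (x : V) (S : Finset V) : Finset V :=
  S.filter (G.Adj x)

/-- `2|S| - |E(G[S])|`. -/
noncomputable def frd (G : SimpleGraph V) (S : Finset V) : ℤ :=
  2 * (#S : ℤ) - #(edgesIn G S)

theorem mem_edgesIn {S : Finset V} {e : Sym2 V} :
    e ∈ edgesIn G S ↔ (∀ a ∈ e, a ∈ S) ∧ e ∈ G.edgeSet := by
  simp [edgesIn, Finset.mem_sym2_iff]

theorem mk_mem_edgesIn {S : Finset V} {a b : V} :
    s(a, b) ∈ edgesIn G S ↔ a ∈ S ∧ b ∈ S ∧ G.Adj a b := by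
  simp [mem_edgesIn, and_assoc]

theorem mem_nbrs {S : Finset V} {x y : V} : y ∈ nbrs G x S ↔ y ∈ S ∧ G.Adj x y := by
  simp [nbrs]

theorem edgesIn_congr {G' : SimpleGraph V} {S : Finset V}
    (h : ∀ a ∈ S, ∀ b ∈ S, (G.Adj a b ↔ G'.Adj a b)) : edgesIn G S = edgesIn G' S := by
  ext e
  induction e with | _ a b
  simp only [mk_mem_edgesIn]
  constructor
  · rintro ⟨ha, hb, hab⟩; exact ⟨ha, hb, (h a ha b hb).1 hab⟩
  · rintro ⟨ha, hb, hab⟩; exact ⟨ha, hb, (h a ha b hb).2 hab⟩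

theorem frd_congr {G' : SimpleGraph V} {S : Finset V}
    (h : ∀ a ∈ S, ∀ b ∈ S, (G.Adj a b ↔ G'.Adj a b)) : frd G S = frd G' S := by
  rw [frd, frd, edgesIn_congr h]

theorem card_edgesIn_insert {S : Finset V} {x : V} (hx : x ∉ S) :
    #(edgesIn G (insert x S)) = #(edgesIn G S) + #(nbrs G x S) := by
  have hinj : Set.InjOn (fun y => s(x, y)) (nbrs G x S : Set V) := by
    intro a _ b _ h
    exact Sym2.congr_right.1 h
  rw [← Finset.card_image_of_injOn hinj, ← Finset.card_union_of_disjoint]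
  · congr 1
    ext e
    induction e with | _ a b
    simp only [mk_mem_edgesIn, mem_union, mem_image, mem_nbrs, mem_insert]
    constructor
    · rintro ⟨rfl | ha, rfl | hb, h⟩
      · exact absurd h (G.irrefl)
      · exact Or.inr ⟨b, ⟨hb, h⟩, rfl⟩
      · exact Or.inr ⟨a, ⟨ha, h.symm⟩, Sym2.eq_swap⟩
      · exact Or.inl ⟨ha, hb, h⟩
    · rintro (⟨ha, hb, h⟩ | ⟨y, ⟨hy, h⟩, he⟩)
      · exact ⟨Or.inr ha, Or.inr hb, h⟩
      · rcases Sym2.eq_iff.1 he with ⟨rfl, rfl⟩ | ⟨rfl, rfl⟩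
        · exact ⟨Or.inl rfl, Or.inr hy, h⟩
        · exact ⟨Or.inr hy, Or.inl rfl, h.symm⟩
  · rw [Finset.disjoint_left]
    intro e he he'
    obtain ⟨y, -, rfl⟩ := mem_image.1 he'
    exact hx (mk_mem_edgesIn.1 he).1

theorem frd_insert {S : Finset V} {x : V} (hx : x ∉ S) :
    frd G (insert x S) = frd G S + 2 - #(nbrs G x S) := by
  rw [frd, frd, card_edgesIn_insert hx, card_insert_of_notMem hx]
  push_cast
  ring

theorem frd_erase {S : Finset V} {x : V} (hx : x ∈ S) :
    frd G (S.erase x) = frd G S - 2 + #(nbrs G x (S.erase x)) := by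
  have := frd_insert (G := G) (notMem_erase x S)
  rw [insert_erase hx] at this
  linarith

theorem frd_empty : frd G ∅ = 0 := by
  simp [frd, edgesIn]

theorem frd_singleton (x : V) : frd G {x} = 2 := by
  have := frd_insert (G := G) (notMem_empty x)
  rw [frd_empty] at this
  simpa [nbrs] using this

theorem edgesIn_inter (A B : Finset V) : edgesIn G (A ∩ B) = edgesIn G A ∩ edgesIn G B := by
  ext e
  induction e with | _ a b
  simp only [mk_mem_edgesIn, mem_inter]
  tauto

theorem edgesIn_mono {A B : Finset V} (h : A ⊆ B) : edgesIn G A ⊆ edgesIn G B := by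
  intro e
  induction e with | _ a b
  simp only [mk_mem_edgesIn]
  exact fun ⟨ha, hb, hab⟩ => ⟨h ha, h hb, hab⟩

/-- Cardinality of vertex sets is modular, and edges inside A and inside B share exactly those
inside A ∩ B. Edges between A \ B and B \ A only lower the left side. -/
theorem frd_union_add_inter_le (A B : Finset V) :
    frd G (A ∪ B) + frd G (A ∩ B) ≤ frd G A + frd G B := by
  have h1 := card_union_add_card_inter A B
  have h2 := card_union_add_card_inter (edgesIn G A) (edgesIn G B)
  rw [← edgesIn_inter] at h2
  have h3 : #(edgesIn G A ∪ edgesIn G B) ≤ #(edgesIn G (A ∪ B)) :=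
    card_le_card (union_subset (edgesIn_mono subset_union_left) (edgesIn_mono subset_union_right))
  simp only [frd]
  omega

theorem nbrs_mono {x : V} {A B : Finset V} (h : A ⊆ B) : nbrs G x A ⊆ nbrs G x B :=
  filter_subset_filter _ h

theorem nbrs_union (x : V) (A B : Finset V) :
    nbrs G x (A ∪ B) = nbrs G x A ∪ nbrs G x B := filter_union _ _ _

theorem sum_card_nbrs (S : Finset V) : ∑ x ∈ S, #(nbrs G x S) = 2 * #(edgesIn G S) := by
  induction S using Finset.induction_on with
  | empty => simp [edgesIn]
  | insert y S hy ih =>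
    have h1 : ∀ x ∈ S, #(nbrs G x (insert y S)) = #(nbrs G x S) + if G.Adj y x then 1 else 0 := by
      intro x _
      rw [nbrs, nbrs, filter_insert]
      by_cases h : G.Adj x y
      · rw [if_pos h, if_pos h.symm, card_insert_of_notMem (by simp [hy])]
      · rw [if_neg h, if_neg (fun h' => h h'.symm), add_zero]
    have h2 : #(nbrs G y (insert y S)) = #(nbrs G y S) := by
      rw [nbrs, nbrs, filter_insert, if_neg G.irrefl]
    rw [sum_insert hy, sum_congr rfl h1, sum_add_distrib, ih, h2, card_edgesIn_insert hy,
      ← card_filter]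
    simp only [nbrs]
    ring

theorem frd_union_of_disjoint {A B : Finset V} (h : Disjoint A B) :
    frd G (A ∪ B) = frd G A + frd G B - ∑ x ∈ A, (#(nbrs G x B) : ℤ) := by
  induction A using Finset.induction_on with
  | empty => simp [frd_empty]
  | insert y A hy ih =>
    rw [disjoint_insert_left] at h
    have hn : #(nbrs G y (A ∪ B)) = #(nbrs G y A) + #(nbrs G y B) := by
      rw [nbrs_union, card_union_of_disjoint]
      exact h.2.mono (filter_subset _ _) (filter_subset _ _)
    rw [insert_union, frd_insert (by simp [hy, h.1]), ih h.2, frd_insert hy, sum_insert hy, hn]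
    push_cast
    ring

/-- `frd` is at least one on nonempty vertex sets. -/
def Sparse (G : SimpleGraph V) : Prop := ∀ S : Finset V, S.Nonempty → 1 ≤ frd G S

theorem frd_eq_freedom_induce [Finite V] (S : Finset V) :
    frd G S = freedom ((⊤ : G.Subgraph).induce (S : Set V)) := by
  have : ((⊤ : G.Subgraph).induce (S : Set V)).edgeSet = (edgesIn G S : Set (Sym2 V)) := by
    ext e
    induction e with | _ a b
    simp [mk_mem_edgesIn]
  rw [freedom, this, Set.ncard_coe_finset, SimpleGraph.Subgraph.induce_verts,
    Set.ncard_coe_finset, frd]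

/-- A subgraph has at least the freedom of the induced subgraph on its vertices. Sets without edges
may be included because `frd` is 2|S| there. -/
theorem isTight_one_iff [Fintype V] : IsTight 1 G ↔ Sparse G ∧ frd G univ = 1 := by
  have htop : frd G univ = freedom (⊤ : G.Subgraph) := by
    rw [frd_eq_freedom_induce]
    congr 1
    ext <;> simp
  rw [IsTight, htop]
  refine and_congr_left fun _ => ⟨fun h S hS => ?_, fun h H hH => ?_⟩
  · by_cases hE : (edgesIn G S).Nonempty
    · have := h ((⊤ : G.Subgraph).induce (S : Set V)) (by
        obtain ⟨e, he⟩ := hE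
        refine ⟨e, ?_⟩
        induction e with | _ a b
        simpa [mk_mem_edgesIn] using he)
      rw [← frd_eq_freedom_induce] at this
      exact_mod_cast this
    · rw [not_nonempty_iff_eq_empty] at hE
      have := hS.card_pos
      simp only [frd, hE, card_empty]
      omega
  · have hV : H.verts = ((Set.toFinite H.verts).toFinset : Set V) := by simp
    set S := (Set.toFinite H.verts).toFinset with hS
    have hsub : H.edgeSet ⊆ (edgesIn G S : Set (Sym2 V)) := by
      intro e
      induction e with | _ a b
      intro hab
      rw [SimpleGraph.Subgraph.mem_edgeSet] at hab
      simp only [mem_coe, mk_mem_edgesIn, hS, Set.Finite.mem_toFinset]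
      exact ⟨hab.fst_mem, hab.snd_mem, hab.adj_sub⟩
    have hne : S.Nonempty := by
      obtain ⟨e, he⟩ := hH
      induction e with | _ a b
      have := hsub he
      exact ⟨a, (mk_mem_edgesIn.1 this).1⟩
    have h1 := h S hne
    have h2 := Set.ncard_le_ncard hsub (Finset.finite_toSet _)
    rw [Set.ncard_coe_finset] at h2
    rw [freedom, hV, Set.ncard_coe_finset]
    rw [frd] at h1
    push_cast
    omega

theorem frd_map {W : Type*} (f : W ↪ V) (S : Finset W) :
    frd (G.comap f) S = frd G (S.map f) := by
  have : edgesIn G (S.map f) = (edgesIn (G.comap f) S).map f.sym2Map := by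
    ext e
    induction e with | _ a b
    simp only [mk_mem_edgesIn, mem_map, Function.Embedding.sym2Map_apply]
    constructor
    · rintro ⟨⟨x, hx, rfl⟩, ⟨y, hy, rfl⟩, h⟩
      exact ⟨s(x, y), mk_mem_edgesIn.2 ⟨hx, hy, h⟩, rfl⟩
    · rintro ⟨e, he, h⟩
      induction e with | _ x y
      rw [mk_mem_edgesIn] at he
      rcases Sym2.eq_iff.1 h with ⟨rfl, rfl⟩ | ⟨rfl, rfl⟩
      · exact ⟨⟨x, he.1, rfl⟩, ⟨y, he.2.1, rfl⟩, he.2.2⟩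
      · exact ⟨⟨y, he.2.1, rfl⟩, ⟨x, he.1, rfl⟩, he.2.2.symm⟩
  rw [frd, frd, this, card_map, card_map]

theorem isTight_induce {Q : SimpleGraph V} {W : Finset V} (h1 : ∀ S ⊆ W, S.Nonempty → 1 ≤ frd Q S)
    (h2 : frd Q W = 1) : IsTight 1 (Q.induce (W : Set V)) := by
  let : Fintype (W : Set V) := inferInstanceAs (Fintype W)
  rw [isTight_one_iff]
  have key : ∀ S : Finset (W : Set V), frd (Q.induce (W : Set V)) S =
    frd Q (S.map (Function.Embedding.subtype _)) := fun S => frd_map _ S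
  refine ⟨fun S hS => ?_, ?_⟩
  · rw [key]
    refine h1 _ ?_ (hS.map)
    intro x hx
    simp only [mem_map, Function.Embedding.coe_subtype] at hx
    obtain ⟨y, -, rfl⟩ := hx
    exact y.2
  · rw [key, ← h2]
    congr 1
    ext x
    simp

end Counting

/-! ### Blocking sets and extensions of a `K₄` -/

section Structure

open Finset Classical

variable {V : Type u} {G : SimpleGraph V}

theorem frd_union_le_one (hG : Sparse G) {A B : Finset V} (hA : frd G A ≤ 1) (hB : frd G B ≤ 1)
    (hAB : (A ∩ B).Nonempty) : frd G (A ∪ B) ≤ 1 := by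
  have h1 := frd_union_add_inter_le (G := G) A B
  have h2 := hG _ hAB
  omega

/-- Adding v to S would bring one vertex and at least three edges, making `frd` at most 0. -/
theorem not_three_nbrs_mem (hG : Sparse G) {v a b c : V} {S : Finset V} (hS : frd G S ≤ 1)
    (hv : v ∉ S) (ha : G.Adj v a) (hb : G.Adj v b) (hc : G.Adj v c) (hab : a ≠ b) (hac : a ≠ c)
    (hbc : b ≠ c) (haS : a ∈ S) (hbS : b ∈ S) (hcS : c ∈ S) : False := by
  have h1 : ({a, b, c} : Finset V) ⊆ nbrs G v S := by
    intro x hx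
    simp only [mem_insert, mem_singleton] at hx
    rcases hx with rfl | rfl | rfl <;> simp [mem_nbrs, *]
  have h2 := card_le_card h1
  rw [card_eq_three.2 ⟨a, b, c, hab, hac, hbc, rfl⟩] at h2
  have h3 := frd_insert (G := G) hv
  have h4 := hG (insert v S) (insert_nonempty _ _)
  omega

/-- If a and b were not adjacent, a tight S avoiding v would contain both, and so not c. Either c is
adjacent to both a and b, and S ∪ {c} is still tight, or a pair containing c is blocked too, and the
two blocking sets meet and have a tight union. In each case a tight set avoiding v contains all
three neighbours. -/
theorem adj_of_nonadjacent_pairs_blocked (hG : Sparse G) {v a b c : V} (ha : G.Adj v a)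
    (hb : G.Adj v b) (hc : G.Adj v c) (hab : a ≠ b) (hac : a ≠ c) (hbc : b ≠ c)
    (hblock : ∀ x y, (x ∈ ({a, b, c} : Finset V)) → y ∈ ({a, b, c} : Finset V) → x ≠ y →
      ¬ G.Adj x y → ∃ S : Finset V, frd G S ≤ 1 ∧ x ∈ S ∧ y ∈ S ∧ v ∉ S) : G.Adj a b := by
  by_contra hnab
  obtain ⟨S, hS, haS, hbS, hvS⟩ := hblock a b (by simp) (by simp) hab hnab
  have hcS : c ∉ S := fun hcS => not_three_nbrs_mem hG hS hvS ha hb hc hab hac hbc haS hbS hcS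
  by_cases hca : G.Adj c a
  · by_cases hcb : G.Adj c b
    · have h1 : ({a, b} : Finset V) ⊆ nbrs G c S := by
        intro x hx
        simp only [mem_insert, mem_singleton] at hx
        rcases hx with rfl | rfl <;> simp [mem_nbrs, *]
      have h2 := card_le_card h1
      rw [card_pair hab] at h2
      have h3 := frd_insert (G := G) hcS
      exact not_three_nbrs_mem hG (S := insert c S) (by omega) (by simp [hvS, hc.ne]) ha hb hc hab
        hac hbc (by simp [haS]) (by simp [hbS]) (by simp)
    · obtain ⟨S', hS', hbS', hcS', hvS'⟩ := hblock b c (by simp) (by simp) hbc (fun h => hcb h.symm)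
      exact not_three_nbrs_mem hG (frd_union_le_one hG hS hS' ⟨b, by simp [hbS, hbS']⟩)
        (by simp [hvS, hvS']) ha hb hc hab hac hbc (by simp [haS]) (by simp [hbS]) (by simp [hcS'])
  · obtain ⟨S', hS', haS', hcS', hvS'⟩ := hblock a c (by simp) (by simp) hac (fun h => hca h.symm)
    exact not_three_nbrs_mem hG (frd_union_le_one hG hS hS' ⟨a, by simp [haS, haS']⟩)
      (by simp [hvS, hvS']) ha hb hc hab hac hbc (by simp [haS]) (by simp [hbS]) (by simp [hcS'])

theorem nbrs_of_isClique {K : Finset V} (hK : G.IsClique (K : Set V)) {x : V} (hx : x ∈ K) :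
    nbrs G x K = K.erase x := by
  ext y
  simp only [mem_nbrs, mem_erase]
  exact ⟨fun h => ⟨h.2.ne', h.1⟩, fun h => ⟨h.2, hK hx h.2 h.1.symm⟩⟩

theorem two_mul_card_edgesIn_of_isClique {K : Finset V} (hK : G.IsClique (K : Set V)) :
    2 * #(edgesIn G K) = #K * (#K - 1) := by
  rw [← sum_card_nbrs, sum_congr rfl (g := fun _ => #K - 1), sum_const, smul_eq_mul]
  intro x hx
  rw [nbrs_of_isClique hK hx, card_erase_of_mem hx]

theorem frd_isNClique_four {K : Finset V} (hK : G.IsNClique 4 K) : frd G K = 2 := by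
  have := two_mul_card_edgesIn_of_isClique hK.isClique
  rw [hK.card_eq] at this
  rw [frd, hK.card_eq]
  omega

theorem two_le_frd_of_subset_isNClique_four {K S : Finset V} (hK : G.IsNClique 4 K) (hS : S ⊆ K)
    (hne : S.Nonempty) : 2 ≤ frd G S := by
  have h1 := two_mul_card_edgesIn_of_isClique (hK.isClique.subset (coe_subset.2 hS))
  have h2 := card_le_card hS
  have h3 := hne.card_pos
  rw [hK.card_eq] at h2
  rw [frd]
  interval_cases h : #S <;> omega

/-- The vertex sets obtained from `K` by successively adding vertices with exactly two, mutually
adjacent, neighbours in the current set. -/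
inductive TriangleBuilt (G : SimpleGraph V) (K : Finset V) : Finset V → Prop
  | base : TriangleBuilt G K K
  | step {Y : Finset V} {x p q : V} (hY : TriangleBuilt G K Y) (hx : x ∉ Y) (hpq : G.Adj p q)
      (hn : nbrs G x Y = {p, q}) : TriangleBuilt G K (insert x Y)

theorem TriangleBuilt.frd_eq {K Y : Finset V} (hK : G.IsNClique 4 K) (h : TriangleBuilt G K Y) :
    frd G Y = 2 := by
  induction h with
  | base => exact frd_isNClique_four hK
  | step hY hx hpq hn ih =>
    rw [frd_insert hx, ih, hn, card_pair hpq.ne]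
    norm_num

/-- No tight set hides inside Y: removing the last vertex from a subset loses at most two edges, so
`frd` does not increase, and the process ends in a subset of a `K₄` or a single vertex. -/
theorem TriangleBuilt.two_le_frd {K Y : Finset V} (hK : G.IsNClique 4 K)
    (h : TriangleBuilt G K Y) : ∀ S ⊆ Y, S.Nonempty → 2 ≤ frd G S := by
  induction h with
  | base => exact fun S hS hne => two_le_frd_of_subset_isNClique_four hK hS hne
  | @step Y x p q hY hx hpq hn ih =>
    intro S hS hne
    by_cases hxS : x ∈ S
    · have hsub : S.erase x ⊆ Y := subset_insert_iff.1 hS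
      rcases (S.erase x).eq_empty_or_nonempty with he | he
      · have : S = {x} := by rw [← insert_erase hxS, he]; rfl
        rw [this, frd_singleton]
      · have h1 := ih _ hsub he
        have h2 := frd_erase (G := G) hxS
        have h3 := card_le_card (nbrs_mono (G := G) (x := x) hsub)
        rw [hn, card_pair hpq.ne] at h3
        omega
    · exact ih S ((subset_insert_iff_of_notMem hxS).1 hS) hne

/-- No edge that lies in exactly one triangle can be contracted without violating sparsity. -/
def NoContractibleEdge (G : SimpleGraph V) : Prop :=
  ∀ p q u, G.Adj p q → (∀ w, G.Adj p w ∧ G.Adj q w ↔ w = u) →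
    ∃ S : Finset V, p ∈ S ∧ q ∈ S ∧ u ∉ S ∧ frd G S ≤ 1

/-- No copy of `K₄` can be contracted to a vertex without producing a multiple edge. -/
def NoContractibleK4 (G : SimpleGraph V) : Prop :=
  ∀ K : Finset V, G.IsNClique 4 K → ∃ x ∉ K, 2 ≤ #(nbrs G x K)

/-! ### Maximal extensions of a `K₄` by vertices attached along edges -/

section Maximal

variable {K Y : Finset V}

/-- Exactly two neighbours would extend Y, against maximality; four or more would push `frd` from 2
to at most 0. -/
theorem card_nbrs_eq_three (hG : Sparse G) (hK : G.IsNClique 4 K) (hY : TriangleBuilt G K Y)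
    (hmax : ∀ Z, TriangleBuilt G K Z → #Z ≤ #Y) {w a b : V} (hw : w ∉ Y) (hab : G.Adj a b)
    (ha : a ∈ nbrs G w Y) (hb : b ∈ nbrs G w Y) : #(nbrs G w Y) = 3 := by
  have h1 : ({a, b} : Finset V) ⊆ nbrs G w Y := by
    intro x hx
    simp only [mem_insert, mem_singleton] at hx
    rcases hx with rfl | rfl <;> assumption
  have h2 := card_le_card h1
  rw [card_pair hab.ne] at h2
  have h3 : #(nbrs G w Y) ≠ 2 := by
    intro h
    have := eq_of_subset_of_card_le h1 (by rw [h, card_pair hab.ne])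
    have := hmax _ (hY.step hw hab this.symm)
    rw [card_insert_of_notMem hw] at this
    omega
  have h4 := frd_insert (G := G) hw
  rw [hY.frd_eq hK] at h4
  have h5 := hG (insert w Y) (insert_nonempty _ _)
  omega

/-- Each such vertex lowers `frd` by one, and starting from 2 sparsity allows this only once. -/
theorem eq_of_card_nbrs_eq_three (hG : Sparse G) (hK : G.IsNClique 4 K)
    (hY : TriangleBuilt G K Y) {w w' : V} (hw : w ∉ Y) (hw' : w' ∉ Y) (h : #(nbrs G w Y) = 3)
    (h' : #(nbrs G w' Y) = 3) : w = w' := by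
  by_contra hne
  have h1 := frd_insert (G := G) hw
  have h2 := frd_insert (G := G) (S := insert w Y) (x := w') (by simp [hw', Ne.symm hne])
  have h3 := card_le_card (nbrs_mono (G := G) (x := w') (subset_insert w Y))
  have h4 := hG (insert w' (insert w Y)) (insert_nonempty _ _)
  rw [hY.frd_eq hK] at h1
  omega

/-- Otherwise ypq is the only triangle on the edge yp, so some tight S contains y and p but not q.
Uncrossing with Y ∪ {y} gives an intersection with `frd` at most 2, in which y has at most the
neighbour p. Removing y leaves a subset with `frd` at most 1, which `TriangleBuilt.two_le_frd`
forbids. -/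
theorem exists_common_nbr_last (hG : Sparse G) (hC : NoContractibleEdge G) (hK : G.IsNClique 4 K)
    (hY : TriangleBuilt G K Y) {y p q : V} (hy : y ∉ Y) (hpq : G.Adj p q)
    (hn : nbrs G y Y = {p, q}) : ∃ z ∉ insert y Y, G.Adj z y ∧ G.Adj z p := by
  have hp := mem_nbrs.1 (hn ▸ mem_insert_self p {q} : p ∈ nbrs G y Y)
  have hq := mem_nbrs.1 (hn ▸ (by simp) : q ∈ nbrs G y Y)
  by_contra! hcon
  obtain ⟨S, hyS, hpS, hqS, hS⟩ := hC y p q hp.2 (by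
    intro w
    constructor
    · rintro ⟨h1, h2⟩
      by_cases hw : w ∈ insert y Y
      · rcases mem_insert.1 hw with rfl | hw
        · exact absurd h1 G.irrefl
        · have : w ∈ nbrs G y Y := mem_nbrs.2 ⟨hw, h1⟩
          rw [hn] at this
          simp only [mem_insert, mem_singleton] at this
          rcases this with rfl | rfl
          · exact absurd h2 G.irrefl
          · rfl
      · exact absurd h2.symm (hcon w hw h1.symm)
    · rintro rfl
      exact ⟨hq.2, hpq⟩)
  have hY' : TriangleBuilt G K (insert y Y) := hY.step hy hpq hn
  have h1 := frd_union_add_inter_le (G := G) S (insert y Y)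
  have h2 := hG (S ∪ insert y Y) ⟨y, by simp⟩
  rw [hY'.frd_eq hK] at h1
  have h3 := frd_erase (G := G) (S := S ∩ insert y Y) (x := y) (by simp [hyS])
  have h4 : nbrs G y ((S ∩ insert y Y).erase y) ⊆ {p} := by
    intro x hx
    simp only [mem_nbrs, mem_erase, mem_inter, mem_insert] at hx
    have : x ∈ nbrs G y Y := mem_nbrs.2 ⟨by tauto, hx.2⟩
    rw [hn] at this
    simp only [mem_insert, mem_singleton] at this ⊢
    rcases this with rfl | rfl
    · rfl
    · exact absurd hx.1.2.1 hqS
  have h5 := card_le_card h4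
  rw [card_singleton] at h5
  have h6 := hY'.two_le_frd hK ((S ∩ insert y Y).erase y)
    ((erase_subset _ _).trans inter_subset_right) ⟨p, by simp [hpS, hp.1, hp.2.ne']⟩
  omega

/-- The edges yp and yq each have a further common neighbour outside. Both of these vertices have
three neighbours inside by maximality, so they coincide. -/
theorem exists_apex_last (hG : Sparse G) (hC : NoContractibleEdge G) (hK : G.IsNClique 4 K)
    (hY : TriangleBuilt G K Y) {y p q : V} (hy : y ∉ Y) (hpq : G.Adj p q)
    (hn : nbrs G y Y = {p, q}) (hmax : ∀ Z, TriangleBuilt G K Z → #Z ≤ #(insert y Y)) :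
    ∃ z ∉ insert y Y, nbrs G z (insert y Y) = {y, p, q} := by
  have hp := mem_nbrs.1 (hn ▸ mem_insert_self p {q} : p ∈ nbrs G y Y)
  have hq := mem_nbrs.1 (hn ▸ (by simp) : q ∈ nbrs G y Y)
  have hY' : TriangleBuilt G K (insert y Y) := hY.step hy hpq hn
  obtain ⟨z, hz, hzy, hzp⟩ := exists_common_nbr_last hG hC hK hY hy hpq hn
  obtain ⟨z', hz', hzy', hzq'⟩ := exists_common_nbr_last hG hC hK hY hy hpq.symm
    (hn.trans (pair_comm p q))
  have h3 := card_nbrs_eq_three hG hK hY' hmax hz hp.2 (mem_nbrs.2 ⟨by simp, hzy⟩)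
    (mem_nbrs.2 ⟨by simp [hp.1], hzp⟩)
  have h3' := card_nbrs_eq_three hG hK hY' hmax hz' hq.2 (mem_nbrs.2 ⟨by simp, hzy'⟩)
    (mem_nbrs.2 ⟨by simp [hq.1], hzq'⟩)
  obtain rfl := eq_of_card_nbrs_eq_three hG hK hY' hz hz' h3 h3'
  refine ⟨z, hz, (eq_of_subset_of_card_le ?_ ?_).symm⟩
  · intro x hx
    simp only [mem_insert, mem_singleton] at hx
    rcases hx with rfl | rfl | rfl <;> simp [mem_nbrs, *]
  · rw [h3, card_eq_three.2 ⟨y, p, q, hp.2.ne, hq.2.ne, hpq.ne, rfl⟩]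

/-- If `y` is attached to `Y ∪ {p}` along the edge `pq` and `p` to `Y` along the edge `qr`, then the
edge `pr` is contractible. -/
theorem no_second_last_adjacent (hG : Sparse G) (hC : NoContractibleEdge G)
    (hK : G.IsNClique 4 K) (hY : TriangleBuilt G K Y) {p q r y : V} (hp : p ∉ Y)
    (hqr : G.Adj q r) (hnp : nbrs G p Y = {q, r}) (hy : y ∉ insert p Y)
    (hny : nbrs G y (insert p Y) = {p, q})
    (hmax : ∀ Z, TriangleBuilt G K Z → #Z ≤ #(insert y (insert p Y))) : False := by
  have hq := mem_nbrs.1 (hnp ▸ mem_insert_self q {r} : q ∈ nbrs G p Y)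
  have hr := mem_nbrs.1 (hnp ▸ (by simp) : r ∈ nbrs G p Y)
  have hyp := mem_nbrs.1 (hny ▸ mem_insert_self p {q} : p ∈ nbrs G y (insert p Y))
  have hY1 : TriangleBuilt G K (insert p Y) := hY.step hp hqr hnp
  have hY2 : TriangleBuilt G K (insert y (insert p Y)) := hY1.step hy hq.2 hny
  obtain ⟨z, hz, hnz⟩ := exists_apex_last hG hC hK hY1 hy hq.2 hny hmax
  have hnbp : ∀ w ∈ insert y (insert p Y), G.Adj p w → w = y ∨ w = q ∨ w = r := by
    intro w hw h
    rcases mem_insert.1 hw with rfl | hw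
    · exact Or.inl rfl
    rcases mem_insert.1 hw with rfl | hw
    · exact absurd h G.irrefl
    have : w ∈ nbrs G p Y := mem_nbrs.2 ⟨hw, h⟩
    rw [hnp] at this
    simp only [mem_insert, mem_singleton] at this
    exact Or.inr this
  have hyr : ¬ G.Adj y r := by
    intro h
    have : r ∈ nbrs G y (insert p Y) := mem_nbrs.2 ⟨by simp [hr.1], h⟩
    rw [hny] at this
    simp only [mem_insert, mem_singleton] at this
    rcases this with h | h
    · exact hr.2.ne' h
    · exact hqr.ne' h
  have hz3 : #(nbrs G z (insert y (insert p Y))) = 3 := by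
    rw [hnz, card_eq_three]
    exact ⟨y, p, q, hyp.2.ne, by rintro rfl; exact hy (by simp [hq.1]), hq.2.ne, rfl⟩
  -- The edge pr lies in the triangle pqr alone: y is not adjacent to r, and an outside common
  -- neighbour of p and r would have to be z, whose inside neighbours are y, p, q.
  obtain ⟨S, hpS, hrS, hqS, hS⟩ := hC p r q hr.2 (by
    intro w
    constructor
    · rintro ⟨h1, h2⟩
      by_cases hw : w ∈ insert y (insert p Y)
      · rcases hnbp w hw h1 with rfl | rfl | rfl
        · exact absurd h2.symm hyr
        · rfl
        · exact absurd h2 G.irrefl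
      · have h3 := card_nbrs_eq_three hG hK hY2 hmax hw hr.2 (mem_nbrs.2 ⟨by simp, h1.symm⟩)
          (mem_nbrs.2 ⟨by simp [hr.1], h2.symm⟩)
        obtain rfl := eq_of_card_nbrs_eq_three hG hK hY2 hw hz h3 hz3
        have : r ∈ nbrs G w (insert y (insert p Y)) := mem_nbrs.2 ⟨by simp [hr.1], h2.symm⟩
        rw [hnz] at this
        simp only [mem_insert, mem_singleton] at this
        rcases this with h | h | h
        · exact absurd (by simp [← h, hr.1]) hy
        · exact absurd h hr.2.ne'
        · exact absurd h hqr.ne'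
    · rintro rfl
      exact ⟨hq.2, hqr.symm⟩)
  have h1 := frd_union_add_inter_le (G := G) S (insert y (insert p Y))
  have h2 := hG (S ∪ insert y (insert p Y)) ⟨y, by simp⟩
  rw [hY2.frd_eq hK] at h1
  have hrp := hr.2.ne'
  have hry : r ≠ y := by rintro rfl; exact hy (by simp [hr.1])
  -- The intersection has `frd` at most 2, so a vertex with at most one neighbour in it could be
  -- removed to leave a forbidden tight subset. This excludes y first; without y and q, the vertex p
  -- keeps only the neighbour r.
  have key : ∀ x ∈ S ∩ insert y (insert p Y), x ≠ r →
      #(nbrs G x ((S ∩ insert y (insert p Y)).erase x)) ≤ 1 → False := by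
    intro x hx hxr hcard
    have h3 := frd_erase (G := G) hx
    have h6 := hY2.two_le_frd hK ((S ∩ insert y (insert p Y)).erase x)
      ((erase_subset _ _).trans inter_subset_right) ⟨r, by simp [hrS, hr.1, hxr.symm]⟩
    omega
  have hyS : y ∉ S := by
    intro hyS
    refine key y (by simp [hyS]) hry.symm ((card_le_card (t := {p}) ?_).trans_eq (card_singleton _))
    intro x hx
    simp only [mem_nbrs, mem_erase, mem_inter, mem_insert] at hx
    have : x ∈ nbrs G y (insert p Y) := mem_nbrs.2 ⟨by simp only [mem_insert]; tauto, hx.2⟩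
    rw [hny] at this
    simp only [mem_insert, mem_singleton] at this ⊢
    rcases this with rfl | rfl
    · rfl
    · exact absurd hx.1.2.1 hqS
  refine key p (by simp [hpS]) hrp.symm ((card_le_card (t := {r}) ?_).trans_eq (card_singleton _))
  intro x hx
  simp only [mem_nbrs, mem_erase, mem_inter] at hx
  rcases hnbp x hx.1.2.2 hx.2 with rfl | rfl | rfl
  · exact absurd hx.1.2.1 hyS
  · exact absurd hx.1.2.1 hqS
  · simp

/-- If y is attached through x, `no_second_last_adjacent` applies. If not, x and y can be attached
in either order, so each has an apex. The two apexes coincide by uniqueness, but one is adjacent to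
x and the other is not. -/
theorem no_second_last (hG : Sparse G) (hC : NoContractibleEdge G)
    (hK : G.IsNClique 4 K) (hY : TriangleBuilt G K Y) {x a b y p q : V} (hx : x ∉ Y)
    (hab : G.Adj a b) (hnx : nbrs G x Y = {a, b}) (hy : y ∉ insert x Y) (hpq : G.Adj p q)
    (hny : nbrs G y (insert x Y) = {p, q})
    (hmax : ∀ Z, TriangleBuilt G K Z → #Z ≤ #(insert y (insert x Y))) : False := by
  have hp := mem_nbrs.1 (hny ▸ mem_insert_self p {q} : p ∈ nbrs G y (insert x Y))
  have hq := mem_nbrs.1 (hny ▸ (by simp) : q ∈ nbrs G y (insert x Y))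
  have aux : ∀ q', q' ∈ insert x Y → G.Adj x q' → nbrs G y (insert x Y) = {x, q'} → False := by
    intro q' hq' hxq' hny'
    have hq'Y : q' ∈ nbrs G x Y := mem_nbrs.2 ⟨mem_of_mem_insert_of_ne hq' hxq'.ne', hxq'⟩
    rw [hnx] at hq'Y
    simp only [mem_insert, mem_singleton] at hq'Y
    rcases hq'Y with rfl | rfl
    · exact no_second_last_adjacent hG hC hK hY hx hab hnx hy hny' hmax
    · exact no_second_last_adjacent hG hC hK hY hx hab.symm (hnx.trans (pair_comm _ _)) hy hny' hmax
  by_cases hxp : x = p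
  · subst hxp
    exact aux q hq.1 hpq hny
  by_cases hxq : x = q
  · subst hxq
    exact aux p hp.1 hpq.symm (hny.trans (pair_comm _ _))
  have hY1 : TriangleBuilt G K (insert x Y) := hY.step hx hab hnx
  obtain ⟨z, hz, hnz⟩ := exists_apex_last hG hC hK hY1 hy hpq hny hmax
  have hyx : ¬ G.Adj x y := by
    intro h
    have : x ∈ nbrs G y (insert x Y) := mem_nbrs.2 ⟨by simp, h.symm⟩
    rw [hny] at this
    simp only [mem_insert, mem_singleton] at this
    tauto
  have hyY : y ∉ Y := fun h => hy (by simp [h])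
  have hyx' : y ≠ x := fun h => hy (by simp [h])
  have hnyY : nbrs G y Y = {p, q} := by
    rw [← hny]
    ext w
    simp only [mem_nbrs, mem_insert]
    constructor
    · tauto
    · rintro ⟨rfl | h, h'⟩
      · exact absurd h'.symm hyx
      · exact ⟨h, h'⟩
  have hnxY : nbrs G x (insert y Y) = {a, b} := by
    rw [← hnx]
    ext w
    simp only [mem_nbrs, mem_insert]
    constructor
    · rintro ⟨rfl | h, h'⟩
      · exact absurd h' hyx
      · exact ⟨h, h'⟩
    · tauto
  have hcomm := Finset.insert_comm x y Y
  have hY2 : TriangleBuilt G K (insert y Y) := hY.step hyY hpq hnyY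
  have hY3 : TriangleBuilt G K (insert x (insert y Y)) := hY2.step (by simp [hx, hyx'.symm]) hab hnxY
  obtain ⟨z', hz', hnz'⟩ := exists_apex_last hG hC hK hY2 (by simp [hx, hyx'.symm]) hab hnxY
    (by rwa [hcomm])
  rw [hcomm] at hnz' hz' hY3
  have ha := mem_nbrs.1 (hnx ▸ mem_insert_self a {b} : a ∈ nbrs G x Y)
  have hb := mem_nbrs.1 (hnx ▸ (by simp) : b ∈ nbrs G x Y)
  have h1 : #(nbrs G z (insert y (insert x Y))) = 3 := by
    rw [hnz, card_eq_three]; exact ⟨y, p, q, hp.2.ne, hq.2.ne, hpq.ne, rfl⟩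
  have h2 : #(nbrs G z' (insert y (insert x Y))) = 3 := by
    rw [hnz', card_eq_three]; exact ⟨x, a, b, ha.2.ne, hb.2.ne, hab.ne, rfl⟩
  obtain rfl := eq_of_card_nbrs_eq_three hG hK hY3 hz hz' h1 h2
  have : x ∈ nbrs G z (insert y (insert x Y)) := by rw [hnz']; simp
  rw [hnz] at this
  simp only [mem_insert, mem_singleton] at this
  rcases this with h | h | h
  · exact hyx' h.symm
  · exact hxp h
  · exact hxq h

end Maximal

/-- Every `K₄` extends either to `K₅` minus an edge or by two vertices to two copies of `K₄` sharing
an edge. -/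
theorem exists_extension_of_isNClique_four [Fintype V] (hG : Sparse G) (hC : NoContractibleEdge G)
    (hN : NoContractibleK4 G) {K : Finset V} (hK : G.IsNClique 4 K) :
    (∃ x ∉ K, #(nbrs G x K) = 3) ∨ ∃ y ∉ K, ∃ p q, G.Adj p q ∧ nbrs G y K = {p, q} ∧
      ∃ z ∉ insert y K, nbrs G z (insert y K) = {y, p, q} := by
  obtain ⟨Y, hY, hmax⟩ := exists_max_image (univ.filter (TriangleBuilt G K)) card
    ⟨K, by simp [TriangleBuilt.base]⟩
  simp only [mem_filter, mem_univ, true_and] at hY hmax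
  cases hY with
  | base =>
    left
    obtain ⟨x, hx, h2⟩ := hN K hK
    refine ⟨x, hx, ?_⟩
    obtain ⟨a, ha, b, hb, hab⟩ := one_lt_card.1 h2
    exact card_nbrs_eq_three hG hK .base hmax hx
      (hK.isClique (mem_nbrs.1 ha).1 (mem_nbrs.1 hb).1 hab) ha hb
  | @step Y y p q hY hy hpq hn =>
    cases hY with
    | base =>
      exact Or.inr ⟨y, hy, p, q, hpq, hn, exists_apex_last hG hC hK .base hy hpq hn hmax⟩
    | step hY hx hab hnx => exact (no_second_last hG hC hK hY hx hab hnx hy hpq hn hmax).elim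

end Structure

/-! ### Minimal tight sets and the degree count -/

section BaseSets

open Finset Classical

variable {V : Type u} {G : SimpleGraph V}

/-- A graph isomorphism onto an induced subgraph from an injective adjacency-preserving map. -/
theorem nonempty_iso_induce {W : Type*} {H : SimpleGraph W} {T : Set V} (f : W → V)
    (hinj : Function.Injective f) (hT : ∀ v, v ∈ T ↔ ∃ w, f w = v)
    (hadj : ∀ a b, H.Adj a b ↔ G.Adj (f a) (f b)) : Nonempty (H ≃g G.induce T) := by
  refine ⟨⟨Equiv.ofBijective (fun w => ⟨f w, (hT _).2 ⟨w, rfl⟩⟩) ⟨?_, ?_⟩, ?_⟩⟩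
  · intro a b h
    exact hinj (congrArg Subtype.val h)
  · rintro ⟨v, hv⟩
    obtain ⟨w, rfl⟩ := (hT v).1 hv
    exact ⟨w, rfl⟩
  · intro a b
    exact (hadj a b).symm

/-- A graph isomorphism onto an induced subgraph from a map onto its vertex set, by counting. -/
theorem nonempty_iso_induce_of_card {n : ℕ} {H : SimpleGraph (Fin n)} {T : Finset V} (f : Fin n → V)
    (hcard : #T = n) (hT : univ.image f = T) (hadj : ∀ a b, H.Adj a b ↔ G.Adj (f a) (f b)) :
    Nonempty (H ≃g G.induce (T : Set V)) := by
  refine nonempty_iso_induce f ?_ ?_ hadj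
  · have : Set.InjOn f (univ : Finset (Fin n)) := by
      rw [← card_image_iff, hT, hcard, card_univ, Fintype.card_fin]
    simpa [Set.injOn_univ] using this
  · intro v
    simp [← hT]

theorem K5MinusEdge_adj_iff {x v a b c : V} (hxv : ¬ G.Adj x v) (hxa : G.Adj x a) (hxb : G.Adj x b)
    (hxc : G.Adj x c) (hva : G.Adj v a) (hvb : G.Adj v b) (hvc : G.Adj v c) (hab : G.Adj a b)
    (hac : G.Adj a c) (hbc : G.Adj b c) (i j : Fin 5) :
    K5MinusEdge.Adj i j ↔ G.Adj (![x, v, a, b, c] i) (![x, v, a, b, c] j) := by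
  have hvx : ¬ G.Adj v x := fun h => hxv h.symm
  fin_cases i <;> fin_cases j <;>
    simp [K5MinusEdge, hxv, hvx, hva, hvb, hvc, hab, hac, hbc, hxa, hxb, hxc, hva.symm, hvb.symm,
      hvc.symm, hab.symm, hac.symm, hbc.symm, hxa.symm, hxb.symm, hxc.symm]

theorem twoK4_adj_iff {a b p q y z : V} (hab : G.Adj a b) (hap : G.Adj a p) (haq : G.Adj a q)
    (hbp : G.Adj b p) (hbq : G.Adj b q) (hpq : G.Adj p q) (hyp : G.Adj y p) (hyq : G.Adj y q)
    (hzp : G.Adj z p) (hzq : G.Adj z q) (hzy : G.Adj z y) (hya : ¬ G.Adj y a) (hyb : ¬ G.Adj y b)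
    (hza : ¬ G.Adj z a) (hzb : ¬ G.Adj z b) (i j : Fin 6) :
    twoK4.Adj i j ↔ G.Adj (![a, b, p, q, y, z] i) (![a, b, p, q, y, z] j) := by
  have hay : ¬ G.Adj a y := fun h => hya h.symm
  have hby : ¬ G.Adj b y := fun h => hyb h.symm
  have haz : ¬ G.Adj a z := fun h => hza h.symm
  have hbz : ¬ G.Adj b z := fun h => hzb h.symm
  have h1 : twoK4.Adj i j ↔ (i ≠ j ∧ ((i ≤ 3 ∧ j ≤ 3) ∨ (2 ≤ i ∧ 2 ≤ j))) := Iff.rfl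
  rw [h1]
  fin_cases i <;> fin_cases j
  all_goals first
    | exact iff_of_true (by decide) (by first | assumption | (apply G.adj_symm; assumption))
    | exact iff_of_false (by decide) (by first | assumption | exact G.irrefl)

/-- A minimal tight vertex set inducing one of the two starting graphs. -/
structure IsBaseSet (G : SimpleGraph V) (T : Finset V) : Prop where
  frd_eq : frd G T = 1
  eq_of_subset : ∀ S ⊆ T, S.Nonempty → frd G S ≤ 1 → S = T
  iso : Nonempty (K5MinusEdge ≃g G.induce (T : Set V)) ∨
    Nonempty (twoK4 ≃g G.induce (T : Set V))

theorem exists_eq_insert_three {K : Finset V} (hK : #K = 4) {A : Finset V} (hA : A ⊆ K)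
    (hA3 : #A = 3) : ∃ v ∉ A, K = insert v A := by
  have h : #(K \ A) = 1 := by rw [card_sdiff_of_subset hA, hK, hA3]
  obtain ⟨v, hv⟩ := card_eq_one.1 h
  have hv' : v ∈ K \ A := by rw [hv]; simp
  refine ⟨v, (mem_sdiff.1 hv').2, ?_⟩
  rw [insert_eq, ← hv, sdiff_union_of_subset hA]

/-- Subsets of Y have `frd` at least 2, so reaching 1 needs z together with all three of its edges.
-/
theorem three_nbrs_mem_of_frd_le_one {Y S : Finset V} {z : V}
    (hY : ∀ S ⊆ Y, S.Nonempty → 2 ≤ frd G S) (hS : S ⊆ insert z Y) (hne : S.Nonempty)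
    (h1 : frd G S ≤ 1) (hz3 : #(nbrs G z Y) = 3) : z ∈ S ∧ nbrs G z Y ⊆ S := by
  have hzS : z ∈ S := by
    by_contra hzS
    have := hY S ((subset_insert_iff_of_notMem hzS).1 hS) hne
    omega
  refine ⟨hzS, ?_⟩
  have hsub : S.erase z ⊆ Y := subset_insert_iff.1 hS
  rcases (S.erase z).eq_empty_or_nonempty with he | he
  · have : S = {z} := by rw [← insert_erase hzS, he]; rfl
    rw [this, frd_singleton] at h1
    omega
  · have h2 := hY _ hsub he
    have h3 := frd_erase (G := G) hzS
    have h4 := eq_of_subset_of_card_le (nbrs_mono (G := G) (x := z) hsub) (by omega)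
    rw [← h4]
    exact (filter_subset _ _).trans (erase_subset _ _)

theorem isBaseSet_K5MinusEdge {K : Finset V} (hK : G.IsNClique 4 K) {x : V} (hx : x ∉ K)
    (hx3 : #(nbrs G x K) = 3) : IsBaseSet G (insert x K) := by
  have hsubK : nbrs G x K ⊆ K := filter_subset _ _
  obtain ⟨v, hv, hKv⟩ := exists_eq_insert_three hK.card_eq hsubK hx3
  have hvK : v ∈ K := by rw [hKv]; simp
  have hxv : ¬ G.Adj x v := fun h => hv (mem_nbrs.2 ⟨hvK, h⟩)
  have hxv' : x ≠ v := by rintro rfl; exact hx hvK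
  obtain ⟨a, b, c, hab, hac, hbc, habc⟩ := card_eq_three.1 hx3
  have ha := mem_nbrs.1 (habc ▸ (by simp) : a ∈ nbrs G x K)
  have hb := mem_nbrs.1 (habc ▸ (by simp) : b ∈ nbrs G x K)
  have hc := mem_nbrs.1 (habc ▸ (by simp) : c ∈ nbrs G x K)
  have hva : G.Adj v a := hK.isClique hvK ha.1 (by rintro rfl; exact hxv ha.2)
  have hvb : G.Adj v b := hK.isClique hvK hb.1 (by rintro rfl; exact hxv hb.2)
  have hvc : G.Adj v c := hK.isClique hvK hc.1 (by rintro rfl; exact hxv hc.2)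
  have gab : G.Adj a b := hK.isClique ha.1 hb.1 hab
  have gac : G.Adj a c := hK.isClique ha.1 hc.1 hac
  have gbc : G.Adj b c := hK.isClique hb.1 hc.1 hbc
  refine ⟨?_, ?_, Or.inl ?_⟩
  · rw [frd_insert hx, frd_isNClique_four hK, hx3]; norm_num
  · intro S hS hne h1
    obtain ⟨hxS, hn⟩ := three_nbrs_mem_of_frd_le_one
      (fun S hS hne => two_le_frd_of_subset_isNClique_four hK hS hne) hS hne h1 hx3
    by_cases hvS : v ∈ S
    · apply hS.antisymm
      rw [hKv]
      exact insert_subset hxS (insert_subset hvS hn)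
    · exfalso
      -- Without the fourth vertex v of K, the tight set S would lie in the other `K₄`, where `frd`
      -- is at least 2.
      have hK' : G.IsNClique 4 (insert x (nbrs G x K)) := by
        refine ⟨?_, ?_⟩
        · rw [coe_insert]
          refine (hK.isClique.subset (coe_subset.2 hsubK)).insert ?_
          intro y hy _
          exact (mem_nbrs.1 hy).2
        · rw [card_insert_of_notMem (fun h => hx (hsubK h)), hx3]
      have : S ⊆ insert x (nbrs G x K) := by
        intro y hy
        have := hS hy
        rw [hKv] at this
        simp only [mem_insert] at this ⊢
        rcases this with h | rfl | h
        · exact Or.inl h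
        · exact absurd hy hvS
        · exact Or.inr h
      have := two_le_frd_of_subset_isNClique_four hK' this hne
      omega
  · refine nonempty_iso_induce_of_card ![x, v, a, b, c] ?_ ?_
      (K5MinusEdge_adj_iff hxv ha.2 hb.2 hc.2 hva hvb hvc gab gac gbc)
    · rw [card_insert_of_notMem hx, hK.card_eq]
    · rw [hKv, habc]
      ext w
      simp [Fin.exists_fin_succ, eq_comm]

theorem isBaseSet_twoK4 {K : Finset V} (hK : G.IsNClique 4 K) {y p q z : V} (hy : y ∉ K)
    (hpq : G.Adj p q) (hny : nbrs G y K = {p, q}) (hz : z ∉ insert y K)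
    (hnz : nbrs G z (insert y K) = {y, p, q}) : IsBaseSet G (insert z (insert y K)) := by
  have hp := mem_nbrs.1 (hny ▸ (by simp) : p ∈ nbrs G y K)
  have hq := mem_nbrs.1 (hny ▸ (by simp) : q ∈ nbrs G y K)
  have hzy := (mem_nbrs.1 (hnz ▸ (by simp) : y ∈ nbrs G z (insert y K))).2
  have hzp := (mem_nbrs.1 (hnz ▸ (by simp) : p ∈ nbrs G z (insert y K))).2
  have hzq := (mem_nbrs.1 (hnz ▸ (by simp) : q ∈ nbrs G z (insert y K))).2
  have hz3 : #(nbrs G z (insert y K)) = 3 := by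
    rw [hnz]; exact card_eq_three.2 ⟨y, p, q, hp.2.ne, hq.2.ne, hpq.ne, rfl⟩
  have hY : TriangleBuilt G K (insert y K) := TriangleBuilt.base.step hy hpq hny
  have hsub : ({p, q} : Finset V) ⊆ K := by
    intro w hw
    simp only [mem_insert, mem_singleton] at hw
    rcases hw with rfl | rfl
    exacts [hp.1, hq.1]
  obtain ⟨m, m', hmm, hKm⟩ := card_eq_two.1
    (show #(K \ {p, q}) = 2 by rw [card_sdiff_of_subset hsub, hK.card_eq, card_pair hpq.ne])
  have hKeq : K = {m, m', p, q} := by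
    rw [← sdiff_union_of_subset hsub, hKm]
    ext w; simp only [mem_union, mem_insert, mem_singleton]; tauto
  have hm := mem_sdiff.1 (hKm ▸ (by simp) : m ∈ K \ {p, q})
  have hm' := mem_sdiff.1 (hKm ▸ (by simp) : m' ∈ K \ {p, q})
  simp only [mem_insert, mem_singleton, not_or] at hm hm'
  have aux : ∀ w ∈ K, w ≠ p → w ≠ q → G.Adj w p ∧ G.Adj w q ∧ ¬ G.Adj y w ∧ ¬ G.Adj z w ∧ w ≠ y
      ∧ w ≠ z := by
    intro w hw hwp hwq
    refine ⟨hK.isClique hw hp.1 hwp, hK.isClique hw hq.1 hwq, ?_, ?_, ?_, ?_⟩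
    · intro h
      have : w ∈ nbrs G y K := mem_nbrs.2 ⟨hw, h⟩
      rw [hny] at this
      simp only [mem_insert, mem_singleton] at this
      tauto
    · intro h
      have : w ∈ nbrs G z (insert y K) := mem_nbrs.2 ⟨by simp [hw], h⟩
      rw [hnz] at this
      simp only [mem_insert, mem_singleton] at this
      rcases this with rfl | rfl | rfl <;> tauto
    · rintro rfl; exact hy hw
    · rintro rfl; exact hz (by simp [hw])
  obtain ⟨hmp, hmq, hym, hzm, hmy, hmz⟩ := aux m hm.1 hm.2.1 hm.2.2
  obtain ⟨hmp', hmq', hym', hzm', hmy', hmz'⟩ := aux m' hm'.1 hm'.2.1 hm'.2.2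
  have hmm' : G.Adj m m' := hK.isClique hm.1 hm'.1 hmm
  refine ⟨?_, ?_, Or.inr ?_⟩
  · rw [frd_insert hz, hY.frd_eq hK, hz3]; norm_num
  · intro S hS hne h1
    obtain ⟨hzS, hn⟩ := three_nbrs_mem_of_frd_le_one (hY.two_le_frd hK) hS hne h1 hz3
    rw [hnz] at hn
    have hL : G.IsNClique 4 ({z, y, p, q} : Finset V) := by
      exact (SimpleGraph.is3Clique_triple_iff.2 ⟨hp.2, hq.2, hpq⟩).insert (by simp [*])
    -- By symmetry the second `K₄` with one of m, m' attached along pq is triangle-built, so it has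
    -- no tight subset. Hence S must contain both m and m'.
    have key : ∀ w, G.Adj w p → G.Adj w q → ¬ G.Adj y w → ¬ G.Adj z w → w ≠ y → w ≠ z →
        ¬ S ⊆ insert w {z, y, p, q} := by
      intro w hwp hwq hyw hzw hwy hwz hSw
      have : TriangleBuilt G {z, y, p, q} (insert w {z, y, p, q}) := by
        refine TriangleBuilt.base.step ?_ hpq ?_
        · simp [hwy, hwz, hwp.ne, hwq.ne]
        · ext t
          simp only [mem_nbrs, mem_insert, mem_singleton]
          constructor
          · rintro ⟨rfl | rfl | rfl | rfl, h⟩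
            · exact absurd h.symm hzw
            · exact absurd h.symm hyw
            · simp
            · simp
          · rintro (rfl | rfl) <;> simp [hwp, hwq]
      have := this.two_le_frd hL S hSw hne
      omega
    by_cases hmS : m ∈ S
    · by_cases hmS' : m' ∈ S
      · apply hS.antisymm
        intro t ht
        rw [hKeq] at ht
        simp only [mem_insert, mem_singleton] at ht
        rcases ht with rfl | rfl | rfl | rfl | rfl | rfl
        any_goals assumption
        all_goals exact hn (by simp)
      · refine (key m hmp hmq hym hzm hmy hmz ?_).elim
        intro t ht
        have := hS ht
        rw [hKeq] at this
        simp only [mem_insert, mem_singleton] at this ⊢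
        rcases this with h | h | h | rfl | h | h
        any_goals tauto
    · refine (key m' hmp' hmq' hym' hzm' hmy' hmz' ?_).elim
      intro t ht
      have := hS ht
      rw [hKeq] at this
      simp only [mem_insert, mem_singleton] at this ⊢
      rcases this with h | h | rfl | h | h | h
      any_goals tauto
  · refine nonempty_iso_induce_of_card ![m, m', p, q, y, z] ?_ ?_
      (twoK4_adj_iff hmm' hmp hmq hmp' hmq' hpq hp.2 hq.2 hzp hzq hzy hym hym' hzm hzm')
    · rw [card_insert_of_notMem hz, card_insert_of_notMem hy, hK.card_eq]
    · rw [hKeq]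
      ext w
      simp only [mem_image, mem_univ, true_and, Fin.exists_fin_succ, eq_comm (b := w)]
      simp
      tauto

theorem exists_isBaseSet [Fintype V] (hG : Sparse G) (hC : NoContractibleEdge G)
    (hN : NoContractibleK4 G) {K : Finset V} (hK : G.IsNClique 4 K) :
    ∃ T, K ⊆ T ∧ IsBaseSet G T := by
  obtain ⟨x, hx, hx3⟩ | ⟨y, hy, p, q, hpq, hny, z, hz, hnz⟩ :=
    exists_extension_of_isNClique_four hG hC hN hK
  · exact ⟨_, subset_insert _ _, isBaseSet_K5MinusEdge hK hx hx3⟩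
  · exact ⟨_, (subset_insert _ _).trans (subset_insert _ _), isBaseSet_twoK4 hK hy hpq hny hz hnz⟩

/-- If every vertex has degree at least three and every vertex of degree three lies in a base set,
some base set is joined to the rest of the graph by at most one edge. -/
theorem exists_isBaseSet_boundary_le_one [Fintype V] (hG : Sparse G) (htop : frd G univ = 1)
    (hdeg : ∀ v, 3 ≤ #(nbrs G v univ))
    (hbase : ∀ v, #(nbrs G v univ) = 3 → ∃ T, v ∈ T ∧ IsBaseSet G T) :
    ∃ T, IsBaseSet G T ∧ ∑ x ∈ T, #(nbrs G x Tᶜ) ≤ 1 := by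
  by_contra! hcon
  set M : Finset (Finset V) := univ.filter (IsBaseSet G) with hM
  -- If two base sets meet, uncrossing makes their intersection tight, and minimality identifies it
  -- with both.
  have hdisj : (M : Set (Finset V)).PairwiseDisjoint id := by
    intro A hA B hB hAB
    simp only [hM, coe_filter, mem_univ, true_and, Set.mem_ofPred_eq] at hA hB
    by_contra hnd
    obtain ⟨x, hxA, hxB⟩ := not_disjoint_iff.1 hnd
    have hne : (A ∩ B).Nonempty := ⟨x, mem_inter.2 ⟨hxA, hxB⟩⟩
    have h1 := frd_union_add_inter_le (G := G) A B
    have h2 := hG (A ∪ B) ⟨x, mem_union_left _ hxA⟩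
    rw [hA.frd_eq, hB.frd_eq] at h1
    exact hAB ((hA.eq_of_subset _ inter_subset_left hne (by omega)).symm.trans
      (hB.eq_of_subset _ inter_subset_right hne (by omega)))
  -- The sum is 4|V| - 2|E|, twice the freedom of G.
  have hsum : ∑ x, (4 - (#(nbrs G x univ) : ℤ)) = 2 := by
    rw [sum_sub_distrib, ← Nat.cast_sum, sum_card_nbrs]
    rw [frd] at htop
    simp only [sum_const, nsmul_eq_mul]
    push_cast
    linarith
  -- For a base set with b boundary edges the sum is 2 · `frd` - b = 2 - b, and b ≥ 2 is assumed.
  have hT : ∀ T ∈ M, ∑ x ∈ T, (4 - (#(nbrs G x univ) : ℤ)) ≤ 0 := by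
    intro T hT
    have hT' : IsBaseSet G T := (mem_filter.1 hT).2
    have h1 : ∀ x, #(nbrs G x univ) = #(nbrs G x T) + #(nbrs G x Tᶜ) := by
      intro x
      rw [← union_compl T, nbrs_union, card_union_of_disjoint]
      exact disjoint_compl_right.mono (filter_subset _ _) (filter_subset _ _)
    have h2 := hcon T hT'
    have h3 := hT'.frd_eq
    have h4 := sum_card_nbrs (G := G) T
    rw [frd] at h3
    rw [sum_sub_distrib, ← Nat.cast_sum, sum_congr rfl (fun x _ => h1 x), sum_add_distrib, h4]
    simp only [sum_const, nsmul_eq_mul]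
    push_cast
    zify at h2
    linarith
  have hle : ∑ x, (4 - (#(nbrs G x univ) : ℤ)) ≤ ∑ x ∈ M.biUnion id, (4 - (#(nbrs G x univ) : ℤ)) := by
    rw [← sum_sdiff (subset_univ (M.biUnion id))]
    have : ∑ x ∈ univ \ M.biUnion id, (4 - (#(nbrs G x univ) : ℤ)) ≤ 0 := by
      refine sum_nonpos fun x hx => ?_
      have h1 := hdeg x
      have h2 : #(nbrs G x univ) ≠ 3 := by
        intro h
        obtain ⟨T, hxT, hT⟩ := hbase x h
        refine (mem_sdiff.1 hx).2 (mem_biUnion.2 ⟨T, ?_, hxT⟩)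
        simp [hM, hT]
      omega
    linarith
  rw [sum_biUnion hdisj] at hle
  have := sum_nonpos hT
  simp only [id] at hle
  linarith

end BaseSets

/-! ### Inverse moves and the induction on the number of vertices -/

section Reductions

open Finset Classical

variable {V : Type u} {G : SimpleGraph V}

theorem nonempty_iso_of_bijective {W : Type*} {H : SimpleGraph W} (f : W → V)
    (hf : Function.Bijective f) (hadj : ∀ a b, H.Adj a b ↔ G.Adj (f a) (f b)) :
    Nonempty (H ≃g G) :=
  ⟨⟨Equiv.ofBijective f hf, fun {a b} => (hadj a b).symm⟩⟩

theorem nonempty_addVertex_iso {W : Set V} {v : V} (hW : ∀ x, x ∈ W ↔ x ≠ v) (H : SimpleGraph W)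
    (S : Set W) (hH : ∀ x y : W, H.Adj x y ↔ G.Adj x y) (hS : ∀ x : W, x ∈ S ↔ G.Adj v x) :
    Nonempty (addVertex H S ≃g G) := by
  refine nonempty_iso_of_bijective (fun o => o.elim v Subtype.val) ⟨?_, ?_⟩ ?_
  · rintro (_ | x) (_ | y) h
    · rfl
    · exact absurd h.symm ((hW _).1 y.2)
    · exact absurd h ((hW _).1 x.2)
    · exact congrArg some (Subtype.ext h)
  · intro x
    by_cases hx : x = v
    · exact ⟨none, hx.symm⟩
    · exact ⟨some ⟨x, (hW x).2 hx⟩, rfl⟩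
  · rintro (_ | x) (_ | y)
    · exact iff_of_false id G.irrefl
    · exact hS y
    · exact (hS x).trans (G.adj_comm _ _)
    · exact hH x y

/-- The graph obtained by identifying all vertices of `K` with the vertex `k` of `K`; the vertices
of `K` other than `k` are to be discarded. -/
def contraction (G : SimpleGraph V) (K : Finset V) (k : V) : SimpleGraph V where
  Adj x y := x ≠ y ∧ (G.Adj x y ∨ (x = k ∧ ∃ c ∈ K, G.Adj c y) ∨ (y = k ∧ ∃ c ∈ K, G.Adj c x))
  symm := ⟨fun _ _ h => ⟨h.1.symm, h.2.imp (fun h => h.symm) Or.symm⟩⟩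
  loopless := ⟨fun _ h => h.1 rfl⟩

theorem contraction_adj_of_ne {K : Finset V} {k x y : V} (hx : x ≠ k) (hy : y ≠ k) :
    (contraction G K k).Adj x y ↔ G.Adj x y := by
  simp only [contraction, hx, hy, false_and, or_false]
  exact ⟨fun h => h.2, fun h => ⟨h.ne, h⟩⟩

theorem contraction_adj_left {K : Finset V} {k y : V} (hk : k ∈ K) (hy : y ∉ K) :
    (contraction G K k).Adj k y ↔ ∃ c ∈ K, G.Adj c y := by
  have hyk : k ≠ y := by rintro rfl; exact hy hk
  simp only [contraction, hyk.symm, false_and, or_false, true_and]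
  constructor
  · rintro ⟨-, h | h⟩
    · exact ⟨k, hk, h⟩
    · exact h
  · exact fun h => ⟨hyk, Or.inr h⟩

/-- Collapsing K replaces its contribution `frd G K` by the 2 of a single vertex; the last two terms
count the edges lost when parallel edges merge. -/
theorem frd_contraction {K R : Finset V} {k : V} (hk : k ∈ K) (hR : Disjoint K R) :
    frd (contraction G K k) (insert k R) = frd G (K ∪ R) + 2 - frd G K
      + ∑ c ∈ K, (#(nbrs G c R) : ℤ) - #(K.biUnion fun c => nbrs G c R) := by
  have hkR : k ∉ R := disjoint_left.1 hR hk
  have h1 : frd (contraction G K k) R = frd G R := frd_congr fun a ha b hb =>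
    contraction_adj_of_ne (by rintro rfl; exact hkR ha) (by rintro rfl; exact hkR hb)
  have h2 : nbrs (contraction G K k) k R = K.biUnion fun c => nbrs G c R := by
    ext y
    simp only [mem_nbrs, mem_biUnion]
    constructor
    · rintro ⟨hy, h⟩
      obtain ⟨c, hc, h⟩ := (contraction_adj_left hk (disjoint_right.1 hR hy)).1 h
      exact ⟨c, hc, hy, h⟩
    · rintro ⟨c, hc, hy, h⟩
      exact ⟨hy, (contraction_adj_left hk (disjoint_right.1 hR hy)).2 ⟨c, hc, h⟩⟩
  rw [frd_insert hkR, h1, h2, frd_union_of_disjoint hR]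
  ring

theorem nonempty_replaceVertex_iso {K : Finset V} {k : V} (hk : k ∈ K) {W : Set V}
    (hW : ∀ x, x ∈ W ↔ (x ∈ K → x = k)) {ι : Type} (f : ι → V) (hf : Function.Injective f)
    (hfK : ∀ x, x ∈ K ↔ ∃ i, f i = x) (hclique : G.IsClique (K : Set V)) (R : W → ι → Prop)
    (hR : ∀ x : W, x.1 ≠ k → ∀ i, R x i ↔ G.Adj x (f i)) :
    Nonempty (replaceVertex ((contraction G K k).induce W) ⟨k, (hW k).2 fun _ => rfl⟩ ι R ≃g G) := by
  refine nonempty_iso_of_bijective (Sum.elim (fun a => a.1.1) f) ⟨?_, ?_⟩ ?_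
  · rintro (⟨⟨a, ha⟩, ha'⟩ | i) (⟨⟨b, hb⟩, hb'⟩ | j) h
    · exact congrArg Sum.inl (Subtype.ext (Subtype.ext h))
    · refine absurd (Subtype.ext ((hW a).1 ha ((hfK a).2 ⟨j, h.symm⟩))) ha'
    · refine absurd (Subtype.ext ((hW b).1 hb ((hfK b).2 ⟨i, h⟩))) hb'
    · exact congrArg Sum.inr (hf h)
  · intro x
    by_cases hx : x ∈ K
    · obtain ⟨i, rfl⟩ := (hfK x).1 hx
      exact ⟨Sum.inr i, rfl⟩
    · refine ⟨Sum.inl ⟨⟨x, (hW x).2 fun h => absurd h hx⟩, ?_⟩, rfl⟩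
      intro h
      have h' : x = k := congrArg Subtype.val h
      exact hx (h' ▸ hk)
  · rintro (⟨⟨a, ha⟩, ha'⟩ | i) (⟨⟨b, hb⟩, hb'⟩ | j)
    · exact contraction_adj_of_ne (fun h => ha' (Subtype.ext h)) (fun h => hb' (Subtype.ext h))
    · exact hR _ (fun h => ha' (Subtype.ext h)) j
    · exact (hR _ (fun h => hb' (Subtype.ext h)) i).trans (G.adj_comm _ _)
    · exact ⟨fun h => hclique ((hfK _).2 ⟨i, rfl⟩) ((hfK _).2 ⟨j, rfl⟩) (hf.ne h),
        fun h => by rintro rfl; exact G.irrefl h⟩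

theorem nbrs_erase_self (v : V) (S : Finset V) : nbrs G v (S.erase v) = nbrs G v S := by
  ext x
  simp only [mem_nbrs, mem_erase]
  exact ⟨fun h => ⟨h.1.2, h.2⟩, fun h => ⟨⟨h.2.ne', h.1⟩, h.2⟩⟩

theorem frd_contraction_of_notMem {K S : Finset V} {k : V} (hkS : k ∉ S) :
    frd (contraction G K k) S = frd G S :=
  frd_congr fun a ha b hb =>
    contraction_adj_of_ne (by rintro rfl; exact hkS ha) (by rintro rfl; exact hkS hb)

section

variable [Fintype V]

/-- Every smaller tight graph whose vertices lie in `V` is derivable. -/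
def SmallerDerivable (V : Type u) [Fintype V] : Prop :=
  ∀ (Q : SimpleGraph V) (W : Finset V), W ≠ univ → (∀ S ⊆ W, S.Nonempty → 1 ≤ frd Q S) →
    frd Q W = 1 → Derivable (Q.induce (W : Set V))

theorem derivable_of_degree_two (hI : SmallerDerivable V) (hG : Sparse G) (htop : frd G univ = 1)
    {v : V} (hv : #(nbrs G v univ) = 2) : Derivable G := by
  obtain ⟨a, b, hab, hn⟩ := card_eq_two.1 hv
  have hadj : ∀ x, G.Adj v x ↔ x = a ∨ x = b := fun x => by
    have := congrArg (x ∈ ·) hn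
    simpa [mem_nbrs] using this
  have hD : Derivable (G.induce ((univ.erase v : Finset V) : Set V)) := by
    refine hI G _ (fun h => ?_) (fun S _ hne => hG S hne) ?_
    · exact notMem_erase v univ (h.symm.subset (mem_univ v))
    · rw [frd_erase (mem_univ v), nbrs_erase_self, hv, htop]; norm_num
  have ha : a ∈ ((univ.erase v : Finset V) : Set V) := by
    simpa using ((hadj a).2 (Or.inl rfl)).ne'
  have hb : b ∈ ((univ.erase v : Finset V) : Set V) := by
    simpa using ((hadj b).2 (Or.inr rfl)).ne'
  obtain ⟨e⟩ := nonempty_addVertex_iso (G := G) (v := v) (W := ((univ.erase v : Finset V) : Set V))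
    (by simp) (G.induce _) {⟨a, ha⟩, ⟨b, hb⟩} (fun _ _ => Iff.rfl) (by
      intro x
      simp [hadj, Subtype.ext_iff])
  have hM := Derivable.henneberg1 _ (⟨a, ha⟩ : ((univ.erase v : Finset V) : Set V)) ⟨b, hb⟩
    (fun h => hab (congrArg Subtype.val h)) hD
  exact Derivable.iso _ _ e hM

/-- This inverts Henneberg 2. Adding ab lowers `frd` by one exactly on the sets containing both
ends, so only a tight set through a and b avoiding v could obstruct it. -/
theorem derivable_of_unblocked_pair (hI : SmallerDerivable V) (hG : Sparse G)
    (htop : frd G univ = 1) {v a b c : V} (hab : a ≠ b) (hac : a ≠ c) (hbc : b ≠ c)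
    (hn : nbrs G v univ = {a, b, c}) (hnab : ¬ G.Adj a b)
    (hfree : ∀ S : Finset V, a ∈ S → b ∈ S → v ∉ S → 1 < frd G S) : Derivable G := by
  have hadj : ∀ x, G.Adj v x ↔ x = a ∨ x = b ∨ x = c := fun x => by
    have := congrArg (x ∈ ·) hn
    simpa [mem_nbrs] using this
  have hcard : #(nbrs G v univ) = 3 := by rw [hn]; exact card_eq_three.2 ⟨a, b, c, hab, hac, hbc, rfl⟩
  set Q := G ⊔ SimpleGraph.edge a b with hQ
  have hQadj : ∀ x y, Q.Adj x y ↔ G.Adj x y ∨ s(x, y) = s(a, b) := by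
    intro x y
    simp only [hQ, SimpleGraph.sup_adj, SimpleGraph.edge_adj, Sym2.eq_iff]
    constructor
    · tauto
    · rintro (h | h)
      · exact Or.inl h
      · refine Or.inr ⟨h, ?_⟩
        rcases h with ⟨rfl, rfl⟩ | ⟨rfl, rfl⟩
        exacts [hab, hab.symm]
  have hfrd : ∀ S : Finset V, a ∈ S → b ∈ S → frd Q S = frd G S - 1 := by
    intro S ha hb
    have : edgesIn Q S = insert s(a, b) (edgesIn G S) := by
      ext e
      induction e with | _ x y
      simp only [mk_mem_edgesIn, mem_insert, hQadj]
      constructor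
      · tauto
      · rintro (h | h)
        · refine ⟨?_, ?_, Or.inr h⟩ <;> rcases Sym2.eq_iff.1 h with ⟨rfl, rfl⟩ | ⟨rfl, rfl⟩ <;>
            assumption
        · tauto
    rw [frd, frd, this, card_insert_of_notMem (by simp [mk_mem_edgesIn, hnab])]
    push_cast
    ring
  have hfrd' : ∀ S : Finset V, ¬ (a ∈ S ∧ b ∈ S) → frd Q S = frd G S := by
    intro S hS
    refine frd_congr fun x hx y hy => ?_
    rw [hQadj]
    refine or_iff_left ?_
    intro h
    rcases Sym2.eq_iff.1 h with ⟨rfl, rfl⟩ | ⟨rfl, rfl⟩ <;> tauto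
  have hav := ((hadj a).2 (by simp)).ne'
  have hbv := ((hadj b).2 (by simp)).ne'
  have hcv := ((hadj c).2 (by simp)).ne'
  have hD : Derivable (Q.induce ((univ.erase v : Finset V) : Set V)) := by
    refine hI Q _ (fun h => ?_) (fun S hS hne => ?_) ?_
    · exact notMem_erase v univ (h.symm.subset (mem_univ v))
    · by_cases h : a ∈ S ∧ b ∈ S
      · have := hfree S h.1 h.2 (fun hv => notMem_erase v univ (hS hv))
        rw [hfrd S h.1 h.2]
        omega
      · rw [hfrd' S h]
        exact hG S hne
    · rw [hfrd _ (by simp [hav]) (by simp [hbv]), frd_erase (mem_univ v), nbrs_erase_self, hcard,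
        htop]
      norm_num
  have ha : a ∈ ((univ.erase v : Finset V) : Set V) := by simpa using hav
  have hb : b ∈ ((univ.erase v : Finset V) : Set V) := by simpa using hbv
  have hc : c ∈ ((univ.erase v : Finset V) : Set V) := by simpa using hcv
  obtain ⟨e⟩ := nonempty_addVertex_iso (G := G) (v := v) (W := ((univ.erase v : Finset V) : Set V))
    (by simp) ((Q.induce _).deleteEdges {s(⟨a, ha⟩, ⟨b, hb⟩)}) {⟨a, ha⟩, ⟨b, hb⟩, ⟨c, hc⟩} (by
      rintro ⟨x, hx⟩ ⟨y, hy⟩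
      simp only [SimpleGraph.deleteEdges_adj, SimpleGraph.comap_adj, hQadj, Set.mem_singleton_iff,
        Sym2.eq_iff, Subtype.mk.injEq, Function.Embedding.coe_subtype]
      constructor
      · tauto
      · intro h
        refine ⟨Or.inl h, ?_⟩
        rintro (⟨rfl, rfl⟩ | ⟨rfl, rfl⟩)
        exacts [hnab h, hnab h.symm]) (by
      intro x
      simp [hadj, Subtype.ext_iff])
  have hM := Derivable.henneberg2 _ (⟨a, ha⟩ : ((univ.erase v : Finset V) : Set V)) ⟨b, hb⟩ ⟨c, hc⟩
    ((hQadj a b).2 (Or.inr rfl)) (fun h => hac (congrArg Subtype.val h).symm)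
    (fun h => hbc (congrArg Subtype.val h).symm) hD
  exact Derivable.iso _ _ e hM

theorem insert_erase_of_subset_compl {K S : Finset V} {k : V} (hS : S ⊆ (K.erase k)ᶜ) (hkS : k ∈ S) :
    Disjoint K (S.erase k) ∧ insert k (S.erase k) = S := by
  refine ⟨?_, insert_erase hkS⟩
  rw [disjoint_right]
  intro x hx hxK
  have := hS (mem_of_mem_erase hx)
  simp only [mem_compl, mem_erase, not_and] at this
  exact this (ne_of_mem_erase hx) hxK

theorem derivable_of_contractible_K4 (hI : SmallerDerivable V) (hG : Sparse G)
    (htop : frd G univ = 1) {K : Finset V} (hK : G.IsNClique 4 K)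
    (hone : ∀ x ∉ K, #(nbrs G x K) ≤ 1) : Derivable G := by
  have huniq : ∀ x ∉ K, ∀ c ∈ K, ∀ d ∈ K, G.Adj x c → G.Adj x d → c = d := by
    intro x hx c hc d hd h1 h2
    exact card_le_one.1 (hone x hx) c (mem_nbrs.2 ⟨hc, h1⟩) d (mem_nbrs.2 ⟨hd, h2⟩)
  obtain ⟨k, hk⟩ : K.Nonempty := card_pos.1 (by rw [hK.card_eq]; norm_num)
  have hfrd : ∀ R, Disjoint K R → frd (contraction G K k) (insert k R) = frd G (K ∪ R) := by
    intro R hR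
    rw [frd_contraction hk hR, frd_isNClique_four hK, card_biUnion]
    · push_cast
      ring
    · intro c hc d hd hcd
      rw [Function.onFun, disjoint_left]
      intro x hx hx'
      rw [mem_nbrs] at hx hx'
      exact hcd (huniq x (disjoint_right.1 hR hx.1) c hc d hd hx.2.symm hx'.2.symm)
  have hD : Derivable ((contraction G K k).induce (((K.erase k)ᶜ : Finset V) : Set V)) := by
    refine hI _ _ (fun h => ?_) (fun S hS hne => ?_) ?_
    · have h4 : #(K.erase k) = 3 := by rw [card_erase_of_mem hk, hK.card_eq]
      rw [compl_eq_univ_iff] at h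
      rw [h] at h4
      simp at h4
    · by_cases hkS : k ∈ S
      · obtain ⟨h1, h2⟩ := insert_erase_of_subset_compl hS hkS
        rw [← h2, hfrd _ h1]
        exact hG _ ⟨k, by simp [hk]⟩
      · rw [frd_contraction_of_notMem hkS]
        exact hG S hne
    · obtain ⟨h1, h2⟩ := insert_erase_of_subset_compl (subset_refl (K.erase k)ᶜ) (k := k) (by simp)
      rw [← h2, hfrd _ h1, ← htop]
      congr 1
      ext x
      by_cases hx : x ∈ K <;> by_cases hxk : x = k <;> simp_all
  let f : Fin 4 → V := fun i => (K.equivFinOfCardEq hK.card_eq).symm i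
  have hf : Function.Injective f := Subtype.val_injective.comp (Equiv.injective _)
  have hfK : ∀ x, x ∈ K ↔ ∃ i, f i = x := by
    intro x
    constructor
    · intro hx
      exact ⟨K.equivFinOfCardEq hK.card_eq ⟨x, hx⟩, by simp [f]⟩
    · rintro ⟨i, rfl⟩
      exact Subtype.prop _
  let W : Set V := (((K.erase k)ᶜ : Finset V) : Set V)
  have hW : ∀ x, x ∈ W ↔ (x ∈ K → x = k) := by
    intro x
    simp only [W, coe_compl, coe_erase, Set.mem_compl_iff, Set.mem_sdiff, mem_coe,
      Set.mem_singleton_iff]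
    tauto
  -- The value 0 at vertices without a neighbour in K is a dummy, since the move reads φ only at
  -- neighbours of the contracted vertex.
  let φ : W → Fin 4 := fun x => if h : ∃ i, G.Adj x (f i) then h.choose else 0
  obtain ⟨e⟩ := nonempty_replaceVertex_iso hk hW f hf hfK hK.isClique
    (fun a i => ((contraction G K k).induce W).Adj a ⟨k, (hW k).2 fun _ => rfl⟩ ∧ φ a = i) (by
      intro x hxk i
      have hxK : x.1 ∉ K := fun h => hxk ((hW x).1 x.2 h)
      have h1 : ((contraction G K k).induce W).Adj x ⟨k, (hW k).2 fun _ => rfl⟩ ↔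
          ∃ i, G.Adj x (f i) := by
        rw [SimpleGraph.adj_comm]
        refine (contraction_adj_left hk hxK).trans ⟨?_, ?_⟩
        · rintro ⟨c, hc, h⟩
          obtain ⟨i, rfl⟩ := (hfK c).1 hc
          exact ⟨i, h.symm⟩
        · rintro ⟨i, h⟩
          exact ⟨f i, (hfK _).2 ⟨i, rfl⟩, h.symm⟩
      rw [h1]
      constructor
      · rintro ⟨h, rfl⟩
        simp only [φ, dif_pos h]
        exact h.choose_spec
      · intro h
        refine ⟨⟨i, h⟩, ?_⟩
        have h' : ∃ i, G.Adj x (f i) := ⟨i, h⟩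
        simp only [φ, dif_pos h']
        exact hf (huniq x hxK _ ((hfK _).2 ⟨_, rfl⟩) _ ((hfK _).2 ⟨_, rfl⟩) h'.choose_spec h))
  exact Derivable.iso _ _ e (Derivable.vertexToK4 _ _ φ hD)

/-- Only pu and qu merge in the contraction. A set through the contracted vertex has the `frd` of
its preimage, reduced by one unless it contains u, so the only obstruction is a tight set containing
p and q but not u. -/
theorem derivable_of_contractible_edge (hI : SmallerDerivable V) (hG : Sparse G)
    (htop : frd G univ = 1) {p q u : V} (hpq : G.Adj p q)
    (hu : ∀ w, G.Adj p w ∧ G.Adj q w ↔ w = u)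
    (hfree : ∀ S : Finset V, p ∈ S → q ∈ S → u ∉ S → 1 < frd G S) : Derivable G := by
  obtain ⟨hpu, hqu⟩ := (hu u).2 rfl
  set K : Finset V := {p, q} with hKdef
  have hpK : p ∈ K := by simp [hKdef]
  have hfrdK : frd G K = 3 := by
    have h1 : nbrs G p {q} = {q} := by
      ext x; simp only [mem_nbrs, mem_singleton]
      exact ⟨fun h => h.1, by rintro rfl; exact ⟨rfl, hpq⟩⟩
    rw [hKdef, frd_insert (by simpa using hpq.ne), frd_singleton, h1]
    simp
  have hfrd : ∀ R, Disjoint K R → frd (contraction G K p) (insert p R) =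
      frd G (K ∪ R) - 1 + if u ∈ R then 1 else 0 := by
    intro R hR
    have h1 := card_union_add_card_inter (nbrs G p R) (nbrs G q R)
    have h2 : nbrs G p R ∩ nbrs G q R = if u ∈ R then {u} else ∅ := by
      ext x
      simp only [mem_inter, mem_nbrs]
      have := hu x
      split_ifs with h
      · simp only [mem_singleton]
        constructor
        · tauto
        · rintro rfl; tauto
      · simp only [notMem_empty, iff_false]
        rintro ⟨⟨hx, h1⟩, -, h2⟩
        exact h (this.1 ⟨h1, h2⟩ ▸ hx)
    rw [frd_contraction hpK hR, hfrdK, hKdef, sum_pair hpq.ne, biUnion_insert, singleton_biUnion]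
    rw [h2] at h1
    split_ifs at h1 ⊢ <;> simp only [card_singleton, card_empty] at h1 <;> omega
  have hD : Derivable ((contraction G K p).induce (((K.erase p)ᶜ : Finset V) : Set V)) := by
    refine hI _ _ (fun h => ?_) (fun S hS hne => ?_) ?_
    · rw [compl_eq_univ_iff] at h
      exact notMem_empty q (h ▸ by simp [hKdef, hpq.ne'])
    · by_cases hkS : p ∈ S
      · obtain ⟨h1, h2⟩ := insert_erase_of_subset_compl hS hkS
        rw [← h2, hfrd _ h1]
        split_ifs with huR
        · have := hG (K ∪ S.erase p) ⟨p, by simp [hpK]⟩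
          omega
        · have := hfree (K ∪ S.erase p) (by simp [hpK]) (by simp [hKdef]) (by
            rw [mem_union, not_or]
            exact ⟨by simp [hKdef, hpu.ne', hqu.ne'], huR⟩)
          omega
      · rw [frd_contraction_of_notMem hkS]
        exact hG S hne
    · obtain ⟨h1, h2⟩ := insert_erase_of_subset_compl (subset_refl (K.erase p)ᶜ) (k := p) (by simp)
      have h3 : K ∪ (K.erase p)ᶜ.erase p = univ := by
        ext x
        by_cases hx : x ∈ K <;> by_cases hxk : x = p <;> simp_all
      have h4 : u ∈ (K.erase p)ᶜ.erase p := by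
        simp [hKdef, hpu.ne', hqu.ne']
      rw [← h2, hfrd _ h1, h3, htop, if_pos h4]
      norm_num
  let W : Set V := (((K.erase p)ᶜ : Finset V) : Set V)
  have hW : ∀ x, x ∈ W ↔ (x ∈ K → x = p) := by
    intro x
    simp only [W, coe_compl, coe_erase, Set.mem_compl_iff, Set.mem_sdiff, mem_coe,
      Set.mem_singleton_iff]
    tauto
  -- Only u is adjacent to both p and q, and the move ignores φ at u, so adjacency to p decides the
  -- rest.
  let φ : W → Fin 2 := fun x => if G.Adj x p then 0 else 1
  have huW : u ∈ W := (hW u).2 (by simp [hKdef, hpu.ne', hqu.ne'])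
  have hcl : G.IsClique (K : Set V) := by
    simp only [hKdef, coe_insert, coe_singleton]
    exact SimpleGraph.isClique_pair.2 fun _ => hpq
  have huK : ∀ y ∉ K, (contraction G K p).Adj y p ↔ G.Adj y p ∨ G.Adj y q := by
    intro y hy
    rw [SimpleGraph.adj_comm, contraction_adj_left hpK hy, hKdef]
    simp [SimpleGraph.adj_comm]
  obtain ⟨e⟩ := nonempty_replaceVertex_iso hpK hW ![p, q] (by
      intro i j h
      have := hpq.ne
      fin_cases i <;> fin_cases j <;> simp_all) (by
      intro x
      simp [hKdef, Fin.exists_fin_two, eq_comm]) hcl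
    (fun a i => a = ⟨u, huW⟩ ∨
      ((contraction G K p).induce W).Adj a ⟨p, (hW p).2 fun _ => rfl⟩ ∧ φ a = i) (by
      rintro ⟨x, hx⟩ hxk i
      have hxK : x ∉ K := fun h => hxk ((hW x).1 hx h)
      have h1 : ((contraction G K p).induce W).Adj ⟨x, hx⟩ ⟨p, (hW p).2 fun _ => rfl⟩ ↔
        G.Adj x p ∨ G.Adj x q := huK x hxK
      have h2 := hu x
      rw [G.adj_comm p, G.adj_comm q] at h2
      simp only [h1, Subtype.mk.injEq, φ]
      by_cases hxp : G.Adj x p <;> by_cases hxq : G.Adj x q <;> fin_cases i <;> simp_all)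
  refine Derivable.iso _ _ e (Derivable.edgeToK3 _ _ _ ?_ φ hD)
  rw [SimpleGraph.comap_adj]
  refine (huK u ?_).2 (Or.inl hpu.symm)
  simp [hKdef, hpu.ne', hqu.ne']

/-- Let b be the number of boundary edges. If T is not everything, then 1 = 1 + `frd G Tᶜ` - b with
`frd G Tᶜ` ≥ 1, so b = 1 and the complement is tight. That is the situation of an edge joining. -/
theorem derivable_of_isBaseSet (hI : SmallerDerivable V) (hG : Sparse G)
    (htop : frd G univ = 1) {T : Finset V} (hT : IsBaseSet G T)
    (hb : ∑ x ∈ T, #(nbrs G x Tᶜ) ≤ 1) : Derivable G := by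
  have hDT : Derivable (G.induce (T : Set V)) := by
    obtain ⟨⟨e⟩⟩ | ⟨⟨e⟩⟩ := hT.iso
    exacts [.base_K5MinusEdge _ e, .base_twoK4 _ e]
  by_cases hTu : T = univ
  · subst hTu
    rw [coe_univ] at hDT
    exact Derivable.iso _ _ (SimpleGraph.induceUnivIso G) hDT
  have hne : Tᶜ.Nonempty := by
    rw [nonempty_iff_ne_empty]
    simpa using hTu
  have h1 := frd_union_of_disjoint (G := G) (disjoint_compl_right (a := T))
  rw [union_compl, htop, hT.frd_eq] at h1
  have h2 := hG _ hne
  have h3 : ∑ x ∈ T, #(nbrs G x Tᶜ) = 1 := by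
    zify at hb ⊢
    omega
  have hDT' : Derivable (G.induce ((Tᶜ : Finset V) : Set V)) := by
    refine hI G _ ?_ (fun S _ hS => hG S hS) ?_
    · rw [Ne, compl_eq_univ_iff]
      rintro rfl
      have := hT.frd_eq
      rw [frd_empty] at this
      omega
    · zify at h3
      omega
  rw [← card_sigma, card_eq_one] at h3
  obtain ⟨⟨u, v⟩, huv⟩ := h3
  have key : ∀ x y, x ∈ T → y ∉ T → (G.Adj x y ↔ x = u ∧ y = v) := by
    intro x y hx hy
    have := congrArg (⟨x, y⟩ ∈ ·) huv
    simpa [mem_nbrs, hx, hy] using this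
  have huv' : (⟨u, v⟩ : Sigma fun _ : V => V) ∈ T.sigma fun x => nbrs G x Tᶜ := by rw [huv]; simp
  simp only [mem_sigma, mem_nbrs, mem_compl] at huv'
  obtain ⟨huT, hvT, hadj⟩ := huv'
  have hvT' : v ∈ ((Tᶜ : Finset V) : Set V) := by simpa using hvT
  have hmem : ∀ x : ((Tᶜ : Finset V) : Set V), x.1 ∉ T := fun x => by
    have := x.2
    simpa using this
  obtain ⟨e⟩ : Nonempty (edgeJoin (G.induce (T : Set V)) (G.induce ((Tᶜ : Finset V) : Set V))
      ⟨u, huT⟩ ⟨v, hvT'⟩ ≃g G) := by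
    refine nonempty_iso_of_bijective (Sum.elim Subtype.val Subtype.val) ⟨?_, ?_⟩ ?_
    · rintro (x | x) (y | y) h
      · exact congrArg Sum.inl (Subtype.ext h)
      · exact absurd (show y.1 ∈ T from (show x.1 = y.1 from h) ▸ x.2) (hmem y)
      · exact absurd (show x.1 ∈ T from (show x.1 = y.1 from h) ▸ y.2) (hmem x)
      · exact congrArg Sum.inr (Subtype.ext h)
    · intro x
      by_cases hx : x ∈ T
      · exact ⟨Sum.inl ⟨x, hx⟩, rfl⟩
      · exact ⟨Sum.inr ⟨x, by simpa using hx⟩, rfl⟩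
    · rintro (x | x) (y | y)
      · simp [edgeJoin, SimpleGraph.edge_adj]
      · have := key x y x.2 (hmem y)
        simp [edgeJoin, SimpleGraph.edge_adj, Subtype.ext_iff, this]
      · have := key y x y.2 (hmem x)
        rw [G.adj_comm] at this
        simp [edgeJoin, SimpleGraph.edge_adj, Subtype.ext_iff, this]
        tauto
      · simp [edgeJoin, SimpleGraph.edge_adj]
  exact Derivable.iso _ _ e (Derivable.edgeJoin _ _ _ _ hDT hDT')

theorem two_le_card_nbrs (hG : Sparse G) (htop : frd G univ = 1) (v : V) :
    2 ≤ #(nbrs G v univ) := by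
  have h1 := frd_erase (G := G) (mem_univ v)
  rw [nbrs_erase_self, htop] at h1
  rcases (univ.erase v).eq_empty_or_nonempty with he | he
  · rw [he, frd_empty] at h1
    have : nbrs G v univ = ∅ := by rw [← nbrs_erase_self, he]; rfl
    rw [this, card_empty] at h1
    omega
  · have := hG _ he
    omega

theorem derivable_of_smallerDerivable (hI : SmallerDerivable V) (hG : Sparse G)
    (htop : frd G univ = 1) : Derivable G := by
  by_contra hnD
  have hdeg : ∀ v, 3 ≤ #(nbrs G v univ) := by
    intro v
    have h1 := two_le_card_nbrs hG htop v
    have h2 : #(nbrs G v univ) ≠ 2 := fun h => hnD (derivable_of_degree_two hI hG htop h)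
    omega
  have hC : NoContractibleEdge G := by
    intro p q u hpq hu
    by_contra! h
    exact hnD (derivable_of_contractible_edge hI hG htop hpq hu h)
  have hN : NoContractibleK4 G := by
    intro K hK
    by_contra! h
    exact hnD (derivable_of_contractible_K4 hI hG htop hK fun x hx => Nat.lt_succ_iff.1 (h x hx))
  have hH : ∀ v a b c, a ≠ b → a ≠ c → b ≠ c → nbrs G v univ = {a, b, c} → ¬ G.Adj a b →
      ∃ S : Finset V, frd G S ≤ 1 ∧ a ∈ S ∧ b ∈ S ∧ v ∉ S := by
    intro v a b c hab hac hbc hn hnab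
    by_contra! h
    exact hnD (derivable_of_unblocked_pair hI hG htop hab hac hbc hn hnab fun S ha hb hv => by
      by_contra! h'
      exact hv (h S h' ha hb))
  obtain ⟨T, hT, hb⟩ := exists_isBaseSet_boundary_le_one hG htop hdeg (by
    intro v hv
    obtain ⟨a, b, c, hab, hac, hbc, hn⟩ := card_eq_three.1 hv
    have hadj : ∀ x, G.Adj v x ↔ x = a ∨ x = b ∨ x = c := fun x => by
      have := congrArg (x ∈ ·) hn
      simpa [mem_nbrs] using this
    have ha := (hadj a).2 (by simp)
    have hb := (hadj b).2 (by simp)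
    have hc := (hadj c).2 (by simp)
    have e1 : ({a, c, b} : Finset V) = {a, b, c} := by ext; simp; tauto
    have e2 : ({b, a, c} : Finset V) = {a, b, c} := by ext; simp; tauto
    have e3 : ({b, c, a} : Finset V) = {a, b, c} := by ext; simp; tauto
    have e4 : ({c, a, b} : Finset V) = {a, b, c} := by ext; simp; tauto
    have e5 : ({c, b, a} : Finset V) = {a, b, c} := by ext; simp; tauto
    have hblock : ∀ x y, (x ∈ ({a, b, c} : Finset V)) → y ∈ ({a, b, c} : Finset V) → x ≠ y →
      ¬ G.Adj x y → ∃ S : Finset V, frd G S ≤ 1 ∧ x ∈ S ∧ y ∈ S ∧ v ∉ S := by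
      intro x y hx hy hxy hnxy
      simp only [mem_insert, mem_singleton] at hx hy
      rcases hx with rfl | rfl | rfl <;> rcases hy with rfl | rfl | rfl
      · exact absurd rfl hxy
      · exact hH v _ _ _ hab hac hbc hn hnxy
      · exact hH v _ _ _ hac hab hbc.symm (hn.trans e1.symm) hnxy
      · exact hH v _ _ _ hab.symm hbc hac (hn.trans e2.symm) hnxy
      · exact absurd rfl hxy
      · exact hH v _ _ _ hbc hab.symm hac.symm (hn.trans e3.symm) hnxy
      · exact hH v _ _ _ hac.symm hbc.symm hab (hn.trans e4.symm) hnxy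
      · exact hH v _ _ _ hbc.symm hac.symm hab.symm (hn.trans e5.symm) hnxy
      · exact absurd rfl hxy
    have gab := adj_of_nonadjacent_pairs_blocked hG ha hb hc hab hac hbc hblock
    have gac := adj_of_nonadjacent_pairs_blocked hG ha hc hb hac hab hbc.symm (by rwa [e1])
    have gbc := adj_of_nonadjacent_pairs_blocked hG hb hc ha hbc hab.symm hac.symm (by rwa [e3])
    have hK : G.IsNClique 4 (insert v {a, b, c}) :=
      (SimpleGraph.is3Clique_triple_iff.2 ⟨gab, gac, gbc⟩).insert (by simp [ha, hb, hc])
    obtain ⟨T, hKT, hT⟩ := exists_isBaseSet hG hC hN hK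
    exact ⟨T, hKT (by simp), hT⟩)
  exact hnD (derivable_of_isBaseSet hI hG htop hT hb)

end

theorem derivable_of_isTight [Finite V] (hG : IsTight 1 G) : Derivable G := by
  obtain ⟨n, hn⟩ : ∃ n, Nat.card V = n := ⟨_, rfl⟩
  induction n using Nat.strong_induction_on generalizing V with
  | _ n ih =>
    let : Fintype V := Fintype.ofFinite V
    obtain ⟨h1, h2⟩ := isTight_one_iff.1 hG
    refine derivable_of_smallerDerivable (fun Q W hW hS hQ => ?_) h1 h2
    refine ih (#W) ?_ (isTight_induce hS hQ) (by simp)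
    rw [← hn, Nat.card_eq_fintype_card, ← card_univ]
    exact card_lt_card (ssubset_univ_iff.2 hW)

end Reductions

/-! ### Oriented decompositions and the moves preserving them -/

section Orientation

variable {V : Type u} {G : SimpleGraph V}

/-- The graph obtained from `G` by deleting the edges `v o(v)`. -/
def restGraph (G : SimpleGraph V) (o : V → V) : SimpleGraph V where
  Adj a b := G.Adj a b ∧ o a ≠ b ∧ o b ≠ a
  symm := ⟨fun _ _ h => ⟨h.1.symm, h.2.2, h.2.1⟩⟩
  loopless := ⟨fun _ h => G.irrefl h.1⟩

theorem restGraph_adj {o : V → V} {a b : V} :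
    (restGraph G o).Adj a b ↔ G.Adj a b ∧ o a ≠ b ∧ o b ≠ a := Iff.rfl

/-- `G` splits into the edges `v o(v)`, which are pairwise distinct, and a connected spanning graph
all of whose edges are of the form `x t(x)` with `x ≠ r`. -/
def HasOrientedDecomposition (G : SimpleGraph V) : Prop :=
  ∃ (o t : V → V) (r : V), (∀ v, G.Adj v (o v)) ∧ (∀ v, o (o v) ≠ v) ∧ (restGraph G o).Connected ∧
    ∀ a b, (restGraph G o).Adj a b → (a ≠ r ∧ t a = b) ∨ (b ≠ r ∧ t b = a)

/-- A graph that maps onto a connected graph with connected fibres is connected. -/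
theorem connected_of_fibers {W : Type*} {T : SimpleGraph V} {T' : SimpleGraph W} [Nonempty W]
    (f : W → V) (hT : T.Connected) (hfib : ∀ x y, f x = f y → T'.Reachable x y)
    (hlift : ∀ a b, T.Adj a b → ∃ x y, f x = a ∧ f y = b ∧ T'.Adj x y) : T'.Connected := by
  have key : ∀ a b, T.Walk a b → ∀ x y, f x = a → f y = b → T'.Reachable x y := by
    intro a b p
    induction p with
    | nil => exact fun x y hx hy => hfib x y (hx.trans hy.symm)
    | cons h p ih =>
      intro x y hx hy
      obtain ⟨x', y', hx', hy', hadj⟩ := hlift _ _ h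
      exact (hfib x x' (hx.trans hx'.symm)).trans (hadj.reachable.trans (ih y' y hy' hy))
  exact ⟨fun x y => (hT (f x) (f y)).elim fun p => key _ _ p x y rfl rfl⟩

theorem HasOrientedDecomposition.of_iso {W : Type*} {G' : SimpleGraph W} (e : G ≃g G')
    (h : HasOrientedDecomposition G) : HasOrientedDecomposition G' := by
  obtain ⟨o, t, r, h1, h2, h3, h4⟩ := h
  refine ⟨fun x => e (o (e.symm x)), fun x => e (t (e.symm x)), e r, fun v => ?_, fun v => ?_, ?_,
    fun a b hab => ?_⟩
  · have := e.map_adj_iff.2 (h1 (e.symm v))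
    simpa using this
  · intro h
    apply h2 (e.symm v)
    apply e.injective
    simpa using h
  · have : Nonempty W := h3.nonempty.map e
    refine connected_of_fibers e.symm h3 (fun x y h => ?_) (fun a b h => ⟨e a, e b, by simp, by simp, ?_⟩)
    · rw [e.symm.injective h]
    · simpa [restGraph_adj, e.map_adj_iff] using h
  · have := h4 (e.symm a) (e.symm b) (by
      obtain ⟨h1, h2, h3⟩ := hab
      refine ⟨e.symm.map_adj_iff.2 h1, fun h => h2 ?_, fun h => h3 ?_⟩ <;> simp [h])
    rcases this with ⟨h, h'⟩ | ⟨h, h'⟩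
    · exact Or.inl ⟨by rintro rfl; simp at h, by simp [h']⟩
    · exact Or.inr ⟨by rintro rfl; simp at h, by simp [h']⟩

/-- Connectedness from a parent function that increases the vertex. -/
theorem connected_of_increasing_parent {n : ℕ} {T : SimpleGraph (Fin (n + 1))}
    (t : Fin (n + 1) → Fin (n + 1)) (h : ∀ i, i ≠ Fin.last n → i < t i ∧ T.Adj i (t i)) :
    T.Connected := by
  have key : ∀ i, T.Reachable i (Fin.last n) := by
    intro i
    induction i using WellFoundedGT.induction with
    | _ i ih =>
      by_cases hi : i = Fin.last n
      · rw [hi]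
      · exact (h i hi).2.reachable.trans (ih _ (h i hi).1)
  exact ⟨fun x y => (key x).trans (key y).symm⟩

theorem K5MinusEdge_adj (i j : Fin 5) :
    K5MinusEdge.Adj i j ↔ i ≠ j ∧ ¬ (i = 0 ∧ j = 1) ∧ ¬ (i = 1 ∧ j = 0) := by
  simp [K5MinusEdge]

theorem hasOrientedDecomposition_K5MinusEdge : HasOrientedDecomposition K5MinusEdge := by
  -- P has the edges 03, 14, 23, 13, 04 and the tree has 02, 12, 24, 34. Parents increase towards
  -- the root 4, whose own entry is a dummy.
  refine ⟨![3, 4, 3, 1, 0], ![2, 2, 4, 4, 4], 4, ?_, by decide, ?_, ?_⟩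
  · simp only [K5MinusEdge_adj]; decide
  · refine connected_of_increasing_parent ![2, 2, 4, 4, 4] ?_
    simp only [restGraph_adj, K5MinusEdge_adj]; decide
  · simp only [restGraph_adj, K5MinusEdge_adj]; decide

theorem twoK4_adj (i j : Fin 6) :
    twoK4.Adj i j ↔ i ≠ j ∧ ((i ≤ 3 ∧ j ≤ 3) ∨ (2 ≤ i ∧ 2 ≤ j)) := Iff.rfl

theorem hasOrientedDecomposition_twoK4 : HasOrientedDecomposition twoK4 := by
  refine ⟨![2, 3, 3, 0, 3, 2], ![1, 2, 4, 5, 5, 5], 5, ?_, by decide, ?_, ?_⟩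
  · simp only [twoK4_adj]; decide
  · refine connected_of_increasing_parent ![1, 2, 4, 5, 5, 5] ?_
    simp only [restGraph_adj, twoK4_adj]; decide
  · simp only [restGraph_adj, twoK4_adj]; decide

@[simp] theorem addVertex_some_some {S : Set V} {a b : V} :
    (addVertex G S).Adj (some a) (some b) ↔ G.Adj a b := Iff.rfl

@[simp] theorem addVertex_some_none {S : Set V} {a : V} :
    (addVertex G S).Adj (some a) none ↔ a ∈ S := Iff.rfl

@[simp] theorem addVertex_none_some {S : Set V} {a : V} :
    (addVertex G S).Adj none (some a) ↔ a ∈ S := Iff.rfl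

/-- Each part receives one new edge: the new vertex points to b in P and hangs as a leaf from a in
the tree. -/
theorem HasOrientedDecomposition.henneberg1 (h : HasOrientedDecomposition G) {a b : V}
    (hab : a ≠ b) : HasOrientedDecomposition (henneberg1 G a b) := by
  obtain ⟨o, t, r, h1, h2, h3, h4⟩ := h
  refine ⟨fun x => some (x.elim b o), fun x => some (x.elim a t), some r, ?_, ?_, ?_, ?_⟩
  · rintro (_ | x)
    · simp [TightGraph.henneberg1]
    · simpa [TightGraph.henneberg1] using h1 x
  · rintro (_ | x)
    · simp
    · simpa using h2 x
  · refine connected_of_fibers (fun x => x.elim a id) h3 ?_ ?_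
    · have : (restGraph (TightGraph.henneberg1 G a b) fun x => some (x.elim b o)).Adj none (some a) := by
        simp [restGraph_adj, TightGraph.henneberg1, hab.symm]
      rintro (_ | x) (_ | y) h
      · rfl
      · obtain rfl : a = y := h
        exact this.reachable
      · obtain rfl : x = a := h
        exact this.symm.reachable
      · obtain rfl : x = y := h
        rfl
    · intro x y hxy
      exact ⟨some x, some y, rfl, rfl, by simpa [restGraph_adj, TightGraph.henneberg1] using hxy⟩
  · rintro (_ | x) (_ | y) h
    · exact absurd h.1 id
    · simp only [restGraph_adj, TightGraph.henneberg1, addVertex_none_some, Set.mem_insert_iff,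
        Set.mem_singleton_iff, Option.elim, ne_eq, Option.some.injEq] at h
      left
      simp; grind
    · simp only [restGraph_adj, TightGraph.henneberg1, addVertex_some_none, Set.mem_insert_iff,
        Set.mem_singleton_iff, Option.elim, ne_eq, Option.some.injEq] at h
      right
      simp; grind
    · have := h4 x y (by simpa [restGraph_adj, TightGraph.henneberg1] using h)
      simpa using this

theorem henneberg2_comm (a b c : V) : henneberg2 G a b c = henneberg2 G b a c := by
  rw [henneberg2, henneberg2, Sym2.eq_swap, Set.insert_comm]

open Classical in
-- The new vertex subdivides ab within its part, keeping the direction; its edge to c goes to the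
-- other part.
theorem HasOrientedDecomposition.henneberg2 (h : HasOrientedDecomposition G) {a b c : V}
    (hab : G.Adj a b) (hca : c ≠ a) (hcb : c ≠ b) :
    HasOrientedDecomposition (henneberg2 G a b c) := by
  obtain ⟨o, t, r, h1, h2, h3, h4⟩ := h
  -- Up to exchanging a and b, the removed edge is directed from a to b in the part containing it.
  wlog hwlog : o a = b ∨ (o b ≠ a ∧ a ≠ r ∧ t a = b) generalizing a b
  · rw [henneberg2_comm]
    refine this hab.symm hcb hca ?_
    by_cases hoa : o a = b
    · exact absurd (Or.inl hoa) hwlog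
    by_cases hob : o b = a
    · exact Or.inl hob
    rcases h4 a b ⟨hab, hoa, hob⟩ with h | h
    · exact absurd (Or.inr ⟨hob, h⟩) hwlog
    · exact Or.inr ⟨hoa, h⟩
  have hne := hab.ne
  by_cases hoa : o a = b
  · have hob : o b ≠ a := by rintro h; exact h2 a (by rw [hoa, h])
    refine ⟨fun x => x.elim (some b) fun x => if x = a then none else some (o x),
      fun x => some (x.elim c t), some r, ?_, ?_, ?_, ?_⟩
    · rintro (_ | x)
      · simp [TightGraph.henneberg2]
      · by_cases hx : x = a
        · simp [TightGraph.henneberg2, hx]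
        · have := h1 x
          simp [TightGraph.henneberg2, hx]
          grind
    · rintro (_ | x)
      · simp [hne.symm]
      · have := h2 x
        by_cases hx : x = a
        · simp [hx, hne.symm]
        · by_cases hx' : o x = a <;> simp [hx, hx', this]
    · refine connected_of_fibers (fun x => x.elim c id) h3 ?_ ?_
      · have : (restGraph (TightGraph.henneberg2 G a b c) fun x => x.elim (some b) fun x =>
            if x = a then none else some (o x)).Adj none (some c) := by
          simp [restGraph_adj, TightGraph.henneberg2, hca, hcb.symm]
        rintro (_ | x) (_ | y) h
        · rfl
        · obtain rfl : c = y := h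
          exact this.reachable
        · obtain rfl : x = c := h
          exact this.symm.reachable
        · obtain rfl : x = y := h
          rfl
      · intro x y hxy
        refine ⟨some x, some y, rfl, rfl, ?_⟩
        rw [restGraph_adj] at hxy
        simp only [restGraph_adj, TightGraph.henneberg2, addVertex_some_some,
          SimpleGraph.deleteEdges_adj, Set.mem_singleton_iff, Sym2.eq_iff, Option.elim]
        grind
    · rintro (_ | x) (_ | y) h
      · exact absurd h.1 id
      · simp only [restGraph_adj, TightGraph.henneberg2, addVertex_none_some, Set.mem_insert_iff,
          Set.mem_singleton_iff, Option.elim, ne_eq, Option.some.injEq] at h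
        left
        simp; grind
      · simp only [restGraph_adj, TightGraph.henneberg2, addVertex_some_none, Set.mem_insert_iff,
          Set.mem_singleton_iff, Option.elim, ne_eq, Option.some.injEq] at h
        right
        simp; grind
      · have := h4 x y (by
          simp only [restGraph_adj, TightGraph.henneberg2, addVertex_some_some,
            SimpleGraph.deleteEdges_adj, Set.mem_singleton_iff, Sym2.eq_iff, Option.elim] at h ⊢
          grind)
        simpa using this
  · obtain ⟨hob, har, hta⟩ := hwlog.resolve_left hoa
    refine ⟨fun x => some (x.elim c o),
      fun x => x.elim (some b) fun x => if x = a then none else some (t x), some r, ?_, ?_, ?_, ?_⟩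
    · rintro (_ | x)
      · simp [TightGraph.henneberg2]
      · have := h1 x
        simp [TightGraph.henneberg2]
        grind
    · rintro (_ | x)
      · simp
      · simpa using h2 x
    · refine connected_of_fibers (fun x => x.elim a id) h3 ?_ ?_
      · have : (restGraph (TightGraph.henneberg2 G a b c) fun x => some (x.elim c o)).Adj none
            (some a) := by
          simp [restGraph_adj, TightGraph.henneberg2, hca]
        rintro (_ | x) (_ | y) h
        · rfl
        · obtain rfl : a = y := h
          exact this.reachable
        · obtain rfl : x = a := h
          exact this.symm.reachable
        · obtain rfl : x = y := h
          rfl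
      · intro x y hxy
        by_cases hx : x = a ∧ y = b
        · exact ⟨none, some b, hx.1.symm, hx.2.symm, by
            simp [restGraph_adj, TightGraph.henneberg2, hcb]⟩
        by_cases hx' : x = b ∧ y = a
        · exact ⟨some b, none, hx'.1.symm, hx'.2.symm, by
            simp [restGraph_adj, TightGraph.henneberg2, hcb]⟩
        refine ⟨some x, some y, rfl, rfl, ?_⟩
        rw [restGraph_adj] at hxy
        simp only [restGraph_adj, TightGraph.henneberg2, addVertex_some_some,
          SimpleGraph.deleteEdges_adj, Set.mem_singleton_iff, Sym2.eq_iff, Option.elim]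
        grind
    · rintro (_ | x) (_ | y) h
      · exact absurd h.1 id
      · simp only [restGraph_adj, TightGraph.henneberg2, addVertex_none_some, Set.mem_insert_iff,
          Set.mem_singleton_iff, Option.elim, ne_eq, Option.some.injEq] at h
        simp; grind
      · simp only [restGraph_adj, TightGraph.henneberg2, addVertex_some_none, Set.mem_insert_iff,
          Set.mem_singleton_iff, Option.elim, ne_eq, Option.some.injEq] at h
        simp; grind
      · simp only [restGraph_adj, TightGraph.henneberg2, addVertex_some_some,
            SimpleGraph.deleteEdges_adj, Set.mem_singleton_iff, Sym2.eq_iff, Option.elim] at h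
        have := h4 x y (by rw [restGraph_adj]; grind)
        simp; grind

open Classical in
-- The root moves one edge at a time. The root r owns no edge, so rs is owned by s; giving it to r
-- frees s to be the new root.
theorem exists_reroot {T : SimpleGraph V} {r r' : V} (p : T.Walk r r') (t : V → V)
    (h : ∀ a b, T.Adj a b → (a ≠ r ∧ t a = b) ∨ (b ≠ r ∧ t b = a)) :
    ∃ t' : V → V, ∀ a b, T.Adj a b → (a ≠ r' ∧ t' a = b) ∨ (b ≠ r' ∧ t' b = a) := by
  induction p generalizing t with
  | nil => exact ⟨t, h⟩
  | @cons r s r' hrs p ih =>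
    refine ih (Function.update t r s) fun a b hab => ?_
    have h1 := h a b hab
    have h2 := h r s hrs
    have h3 := hrs.ne
    simp only [Function.update_apply]
    grind

open Classical in
-- The new edge joins the two trees: once the tree of H is rerooted at v, that vertex is free to
-- take u as its parent.
theorem HasOrientedDecomposition.edgeJoin {W : Type u} {H : SimpleGraph W}
    (hG : HasOrientedDecomposition G) (hH : HasOrientedDecomposition H) (u : V) (v : W) :
    HasOrientedDecomposition (edgeJoin G H u v) := by
  obtain ⟨o, t, r, h1, h2, h3, h4⟩ := hG
  obtain ⟨o', t', r', h1', h2', h3', h4'⟩ := hH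
  obtain ⟨p⟩ := h3' r' v
  obtain ⟨t'', h4''⟩ := exists_reroot p t' h4'
  have hadj : (restGraph (TightGraph.edgeJoin G H u v) (Sum.map o o')).Adj (Sum.inl u) (Sum.inr v) := by
    simp [restGraph_adj, TightGraph.edgeJoin, SimpleGraph.edge_adj]
  refine ⟨Sum.map o o', Sum.elim (fun x => Sum.inl (t x))
    fun y => if y = v then Sum.inl u else Sum.inr (t'' y), Sum.inl r, ?_, ?_, ?_, ?_⟩
  · rintro (x | x)
    · simpa [TightGraph.edgeJoin] using Or.inl (h1 x)
    · simpa [TightGraph.edgeJoin] using Or.inl (h1' x)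
  · rintro (x | x)
    · simpa using h2 x
    · simpa using h2' x
  · have hl : ∀ x, (restGraph (TightGraph.edgeJoin G H u v) (Sum.map o o')).Reachable (Sum.inl x)
        (Sum.inl u) := fun x => (h3 x u).map ⟨Sum.inl, fun {a b} h => by
      rw [restGraph_adj] at h ⊢
      simpa [TightGraph.edgeJoin] using ⟨Or.inl h.1, h.2⟩⟩
    have hr : ∀ x, (restGraph (TightGraph.edgeJoin G H u v) (Sum.map o o')).Reachable (Sum.inr x)
        (Sum.inr v) := fun x => (h3' x v).map ⟨Sum.inr, fun {a b} h => by
      rw [restGraph_adj] at h ⊢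
      simpa [TightGraph.edgeJoin] using ⟨Or.inl h.1, h.2⟩⟩
    have key : ∀ x, (restGraph (TightGraph.edgeJoin G H u v) (Sum.map o o')).Reachable x
        (Sum.inl u) := by
      rintro (x | x)
      · exact hl x
      · exact (hr x).trans hadj.symm.reachable
    have : Nonempty (V ⊕ W) := ⟨Sum.inl u⟩
    exact ⟨fun x y => (key x).trans (key y).symm⟩
  · rintro (x | x) (y | y) h
    · have := h4 x y (by simpa [restGraph_adj, TightGraph.edgeJoin, SimpleGraph.edge_adj] using h)
      simpa using this
    · simp [restGraph_adj, TightGraph.edgeJoin, SimpleGraph.edge_adj] at h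
      simp [h]
    · simp [restGraph_adj, TightGraph.edgeJoin, SimpleGraph.edge_adj] at h
      simp [h]
    · have := h4'' x y (by simpa [restGraph_adj, TightGraph.edgeJoin, SimpleGraph.edge_adj] using h)
      simp only [Sum.elim_inr]
      grind

@[simp] theorem replaceVertex_inl_inl {v : V} {ι : Type} {R : V → ι → Prop} {a b : {a : V // a ≠ v}} :
    (replaceVertex G v ι R).Adj (Sum.inl a) (Sum.inl b) ↔ G.Adj a b := Iff.rfl

@[simp] theorem replaceVertex_inl_inr {v : V} {ι : Type} {R : V → ι → Prop} {a : {a : V // a ≠ v}}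
    {i : ι} : (replaceVertex G v ι R).Adj (Sum.inl a) (Sum.inr i) ↔ R a i := Iff.rfl

@[simp] theorem replaceVertex_inr_inr {v : V} {ι : Type} {R : V → ι → Prop} {i j : ι} :
    (replaceVertex G v ι R).Adj (Sum.inr i) (Sum.inr j) ↔ i ≠ j := Iff.rfl

open Classical in
/-- The vertex replacing `x` when `v` is replaced by `ι`, with `i` taken in place of `v`. -/
noncomputable def replaced (v : V) {ι : Type} (i : ι) (x : V) : {a : V // a ≠ v} ⊕ ι :=
  if h : x = v then Sum.inr i else Sum.inl ⟨x, h⟩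

section Replaced

variable {v : V} {ι : Type} {i j : ι} {x : V} {a : {a : V // a ≠ v}}

theorem replaced_eq_inl : replaced v i x = Sum.inl a ↔ x = a := by
  unfold replaced
  split_ifs with h
  · simp only [false_iff]
    rintro rfl
    exact a.2 h
  · simp [Subtype.ext_iff]

theorem replaced_eq_inr : replaced v i x = Sum.inr j ↔ x = v ∧ i = j := by
  unfold replaced
  split_ifs with h <;> simp [h]

theorem inl_eq_replaced : Sum.inl a = replaced v i x ↔ x = a := by
  rw [eq_comm, replaced_eq_inl]

theorem inr_eq_replaced : Sum.inr j = replaced v i x ↔ x = v ∧ i = j := by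
  rw [eq_comm, replaced_eq_inr]

theorem replaced_of_ne (h : x ≠ v) : replaced v i x = Sum.inl ⟨x, h⟩ := dif_neg h

theorem replaced_self : replaced v i v = Sum.inr i := dif_pos rfl

end Replaced

/-- The next vertex on the way from `i` to `j` on the path `0 - 1 - 2 - 3`. -/
def pathStep (j i : Fin 4) : Fin 4 :=
  if i < j then i + 1 else i - 1

/-- The next vertex on the way from `i` to `j` on the path `2 - 0 - 3 - 1`, the complement of
`0 - 1 - 2 - 3`. -/
def copathStep (j i : Fin 4) : Fin 4 :=
  ![if j = 2 then 2 else 3, 3, 0, if j = 1 then 1 else 0] i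

/-- The edges of `K₄` split into two Hamiltonian paths. One joins P, directed to the vertex that
inherits the out-edge of v; the other joins the tree, directed to the vertex that inherits the
parent edge of v. -/
theorem HasOrientedDecomposition.vertexToK4 (h : HasOrientedDecomposition G) (v : V)
    (φ : V → Fin 4) : HasOrientedDecomposition (vertexToK4 G v φ) := by
  obtain ⟨o, t, r, h1, h2, h3, h4⟩ := h
  set i₀ := φ (o v) with hi₀
  set j₀ := φ (t v) with hj₀
  have hov : o v ≠ v := (h1 v).ne'
  let o' : {a : V // a ≠ v} ⊕ Fin 4 → {a : V // a ≠ v} ⊕ Fin 4 :=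
    Sum.elim (fun a => replaced v (φ a) (o a))
      fun i => if i = i₀ then Sum.inl ⟨o v, hov⟩ else Sum.inr (pathStep i₀ i)
  -- Nothing prevents `t v = v`, for instance at the root, so `replaced` is needed here; its index 0
  -- is then a dummy.
  let t' : {a : V // a ≠ v} ⊕ Fin 4 → {a : V // a ≠ v} ⊕ Fin 4 :=
    Sum.elim (fun a => replaced v (φ a) (t a))
      fun i => if i = j₀ then replaced v 0 (t v) else Sum.inr (copathStep j₀ i)
  have ho_inl : ∀ a, o' (Sum.inl a) = replaced v (φ a) (o a) := fun _ => rfl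
  have ho_inr : ∀ i, o' (Sum.inr i) =
    if i = i₀ then Sum.inl ⟨o v, hov⟩ else Sum.inr (pathStep i₀ i) := fun _ => rfl
  have ht_inl : ∀ a, t' (Sum.inl a) = replaced v (φ a) (t a) := fun _ => rfl
  have ht_inr : ∀ i, t' (Sum.inr i) =
    if i = j₀ then replaced v 0 (t v) else Sum.inr (copathStep j₀ i) := fun _ => rfl
  have hrest_inr : ∀ i j, i ≠ j → (i ≠ i₀ → pathStep i₀ i ≠ j) → (j ≠ i₀ → pathStep i₀ j ≠ i) →
      (restGraph (TightGraph.vertexToK4 G v φ) o').Adj (Sum.inr i) (Sum.inr j) := by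
    intro i j hij hi hj
    rw [restGraph_adj, ho_inr, ho_inr]
    refine ⟨hij, ?_, ?_⟩
    · split_ifs with h
      · simp
      · simpa using hi h
    · split_ifs with h
      · simp
      · simpa using hj h
  refine ⟨o', t', replaced v j₀ r, ?_, ?_, ?_, ?_⟩
  · rintro (⟨a, ha⟩ | i)
    · rw [ho_inl]
      by_cases hoa : o a = v
      · rw [hoa, replaced_self]
        exact ⟨hoa ▸ h1 a, rfl⟩
      · rw [replaced_of_ne hoa]
        exact h1 a
    · rw [ho_inr]
      split_ifs with hi
      · exact ⟨(h1 v).symm, by rw [hi]⟩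
      · have : ∀ i j : Fin 4, i ≠ j → i ≠ pathStep j i := by decide
        exact this i i₀ hi
  · rintro (⟨a, ha⟩ | i)
    · rw [ho_inl]
      by_cases hoa : o a = v
      · simp only [hoa, replaced_self]
        rw [ho_inr]
        split_ifs with hi
        · have := h2 a
          rw [hoa] at this
          simpa using this
        · simp
      · rw [replaced_of_ne hoa, ho_inl, Ne, replaced_eq_inl]
        exact h2 a
    · rw [ho_inr]
      split_ifs with hi
      · rw [ho_inl, Ne, replaced_eq_inr]
        exact fun h => h2 v h.1
      · rw [ho_inr]
        have : ∀ i j : Fin 4, i ≠ j → pathStep j (pathStep j i) ≠ i ∨ pathStep j i = j := by decide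
        have := this i i₀ hi
        split_ifs with hi'
        · simp
        · simpa using this.resolve_right hi'
  · have : Nonempty ({a : V // a ≠ v} ⊕ Fin 4) := ⟨Sum.inr 0⟩
    refine connected_of_fibers (Sum.elim Subtype.val fun _ => v) h3 ?_ ?_
    · have hzero : ∀ i, (restGraph (TightGraph.vertexToK4 G v φ) o').Reachable (Sum.inr i)
          (Sum.inr 0) := by
        -- The edges 20, 03, 31 of the complementary path are never used by `o'`, whichever vertex
        -- inherits the out-edge, so they connect the fibre over v.
        have hp : ∀ k : Fin 4, ((2 ≠ k → pathStep k 2 ≠ 0) ∧ (0 ≠ k → pathStep k 0 ≠ 2)) ∧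
            ((3 ≠ k → pathStep k 3 ≠ 0) ∧ (0 ≠ k → pathStep k 0 ≠ 3)) ∧
            ((1 ≠ k → pathStep k 1 ≠ 3) ∧ (3 ≠ k → pathStep k 3 ≠ 1)) := by decide
        obtain ⟨⟨p20, p02⟩, ⟨p30, p03⟩, p13, p31⟩ := hp i₀
        have e20 := (hrest_inr 2 0 (by decide) p20 p02).reachable
        have e30 := (hrest_inr 3 0 (by decide) p30 p03).reachable
        have e13 := (hrest_inr 1 3 (by decide) p13 p31).reachable
        intro i
        fin_cases i
        exacts [SimpleGraph.Reachable.refl _, e13.trans e30, e20, e30]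
      rintro (⟨a, ha⟩ | i) (⟨b, hb⟩ | j) h
      · obtain rfl : a = b := h
        rfl
      · exact absurd h ha
      · exact absurd h.symm hb
      · exact (hzero i).trans (hzero j).symm
    · intro a b hab
      rw [restGraph_adj] at hab
      by_cases ha : a = v
      · subst ha
        have hb : b ≠ a := hab.1.ne'
        refine ⟨Sum.inr (φ b), Sum.inl ⟨b, hb⟩, rfl, rfl, ⟨hab.1.symm, rfl⟩, ?_, ?_⟩
        · rw [ho_inr]
          split_ifs
          · simpa using hab.2.1
          · simp
        · rw [ho_inl, Ne, replaced_eq_inr]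
          exact fun h => hab.2.2 h.1
      · by_cases hb : b = v
        · subst hb
          refine ⟨Sum.inl ⟨a, ha⟩, Sum.inr (φ a), rfl, rfl, ⟨hab.1, rfl⟩, ?_, ?_⟩
          · rw [ho_inl, Ne, replaced_eq_inr]
            exact fun h => hab.2.1 h.1
          · rw [ho_inr]
            split_ifs
            · simpa using hab.2.2
            · simp
        · refine ⟨Sum.inl ⟨a, ha⟩, Sum.inl ⟨b, hb⟩, rfl, rfl, hab.1, ?_, ?_⟩
          · rw [ho_inl, Ne, replaced_eq_inl]
            exact hab.2.1
          · rw [ho_inl, Ne, replaced_eq_inl]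
            exact hab.2.2
  · have hmix : ∀ a i, (restGraph (TightGraph.vertexToK4 G v φ) o').Adj (Sum.inl a) (Sum.inr i) →
        (Sum.inl a ≠ replaced v j₀ r ∧ t' (Sum.inl a) = Sum.inr i) ∨
          (Sum.inr i ≠ replaced v j₀ r ∧ t' (Sum.inr i) = Sum.inl a) := by
      rintro ⟨a, ha⟩ i ⟨⟨hav, hφ⟩, hoa, hov'⟩
      simp only at hav hφ
      rw [ho_inl, Ne, replaced_eq_inr] at hoa
      have hva : o v ≠ a := by
        intro h
        apply hov'
        rw [ho_inr, if_pos (by rw [hi₀, h, hφ])]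
        simp [h]
      simp only [Ne, inl_eq_replaced, inr_eq_replaced]
      rcases h4 a v ⟨hav, fun h => hoa ⟨h, hφ⟩, hva⟩ with ⟨h, h'⟩ | ⟨h, h'⟩
      · exact Or.inl ⟨h.symm, by rw [ht_inl, h', replaced_self, hφ]⟩
      · refine Or.inr ⟨fun hr => h hr.1.symm, ?_⟩
        rw [ht_inr, if_pos (by rw [hj₀, h', hφ]), replaced_eq_inl]
        exact h'
    rintro (a | i) (b | j) h
    · have := h4 a b (by
        obtain ⟨h, hoa, hob⟩ := h
        rw [ho_inl, Ne, replaced_eq_inl] at hoa hob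
        exact ⟨h, hoa, hob⟩)
      simp only [Ne, inl_eq_replaced, ht_inl, replaced_eq_inl]
      rw [eq_comm (a := r), eq_comm (a := r)]
      exact this
    · exact hmix a j h
    · exact (hmix b i h.symm).symm
    · obtain ⟨h, hi, hj⟩ := h
      rw [ho_inr] at hi hj
      have : ∀ i j i₀ j₀ : Fin 4, i ≠ j → (i ≠ i₀ ∧ pathStep i₀ i = j) ∨ (j ≠ i₀ ∧ pathStep i₀ j = i) ∨
          (i ≠ j₀ ∧ copathStep j₀ i = j) ∨ (j ≠ j₀ ∧ copathStep j₀ j = i) := by decide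
      rcases this i j i₀ j₀ h with ⟨h, h'⟩ | ⟨h, h'⟩ | ⟨h, h'⟩ | ⟨h, h'⟩
      · rw [if_neg h, h'] at hi; exact absurd rfl hi
      · rw [if_neg h, h'] at hj; exact absurd rfl hj
      · left
        rw [ht_inr, if_neg h, h', Ne, inr_eq_replaced]
        exact ⟨fun h'' => h h''.2.symm, rfl⟩
      · right
        rw [ht_inr, if_neg h, h', Ne, inr_eq_replaced]
        exact ⟨fun h'' => h h''.2.symm, rfl⟩

end Orientation

/-! ### The edge-to-`K₃` move on oriented decompositions -/

section EdgeToK3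

variable {V : Type u} {G : SimpleGraph V} {o t : V → V} {r u v : V} {φ : V → Fin 2}

/-- Both new vertices are joined to u, so φ u is a free parameter. It is later chosen so that an
edge directed from u to v goes to the new vertex inheriting the out-edge or parent edge of v. -/
theorem edgeToK3_congr {φ' : V → Fin 2} (h : ∀ a, a ≠ u → φ a = φ' a) :
    edgeToK3 G u v φ = edgeToK3 G u v φ' := by
  unfold edgeToK3
  congr
  funext a i
  by_cases ha : a = u
  · simp [ha]
  · simp [ha, h a ha]

/-- Splitting a vertex along an edge `uv` of the form `x o(x)`. -/
theorem exists_orientation_edgeToK3_of_eq (huv : G.Adj u v) (h1 : ∀ x, G.Adj x (o x))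
    (h2 : ∀ x, o (o x) ≠ x) (h : o v = u ∨ o u = v ∧ φ u = φ (o v)) :
    ∃ o', (∀ x, (edgeToK3 G u v φ).Adj x (o' x)) ∧ (∀ x, o' (o' x) ≠ x) ∧
      (∀ a b, (restGraph (edgeToK3 G u v φ) o').Adj (Sum.inl a) (Sum.inl b) ↔
        (restGraph G o).Adj a b) ∧
      (∀ a i, (restGraph (edgeToK3 G u v φ) o').Adj (Sum.inl a) (Sum.inr i) ↔
        (restGraph G o).Adj a v ∧ φ a = i) ∧
      ∀ i j, (restGraph (edgeToK3 G u v φ) o').Adj (Sum.inr i) (Sum.inr j) ↔ i ≠ j := by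
  have hov : o v ≠ v := (h1 v).ne'
  have huv' : u ≠ v := huv.ne
  -- One new vertex inherits the out-edge of v and the other points to u, which leaves the edge
  -- between them to the tree. If u points to v, it must now point to the inheriting vertex, since
  -- otherwise one edge would be used in both directions.
  let o' : {a : V // a ≠ v} ⊕ Fin 2 → {a : V // a ≠ v} ⊕ Fin 2 :=
    Sum.elim (fun a => replaced v (φ a) (o a))
      fun i => if i = φ (o v) then Sum.inl ⟨o v, hov⟩ else Sum.inl ⟨u, huv'⟩
  have ho_inl : ∀ a, o' (Sum.inl a) = replaced v (φ a) (o a) := fun _ => rfl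
  have ho_inr : ∀ i, o' (Sum.inr i) =
    if i = φ (o v) then Sum.inl ⟨o v, hov⟩ else Sum.inl ⟨u, huv'⟩ := fun _ => rfl
  have h2v := h2 v
  refine ⟨o', ?_, ?_, ?_, ?_, ?_⟩
  · rintro (⟨a, ha⟩ | i)
    · rw [ho_inl]
      by_cases hoa : o a = v
      · rw [hoa, replaced_self]
        exact Or.inr ⟨hoa ▸ h1 a, rfl⟩
      · rw [replaced_of_ne hoa]
        exact h1 a
    · rw [ho_inr]
      split_ifs with hi
      · exact Or.inr ⟨(h1 v).symm, hi.symm⟩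
      · exact Or.inl rfl
  · rintro (⟨a, ha⟩ | i)
    · have h2a := h2 a
      rw [ho_inl]
      by_cases hoa : o a = v
      · simp only [hoa, replaced_self]
        rw [ho_inr]
        rw [hoa] at h2a
        split_ifs with hi
        · simpa using h2a
        · simp only [ne_eq, Sum.inl.injEq, Subtype.mk.injEq]
          rintro rfl
          rcases h with h | h
          · exact h2a h
          · exact hi h.2
      · rw [replaced_of_ne hoa, ho_inl, Ne, replaced_eq_inl]
        exact h2a
    · rw [ho_inr]
      split_ifs with hi
      · rw [ho_inl, Ne, replaced_eq_inr]
        exact fun h => h2v h.1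
      · rw [ho_inl, Ne, replaced_eq_inr]
        rintro ⟨h', h''⟩
        simp only at h' h''
        rcases h with h | h
        · exact h2v (h ▸ h')
        · exact hi (h'' ▸ h.2)
  · intro a b
    simp only [restGraph_adj, ho_inl, Ne, replaced_eq_inl, edgeToK3, replaceVertex_inl_inl]
  · rintro ⟨a, ha⟩ i
    simp only [restGraph_adj, ho_inl, ho_inr, Ne, replaced_eq_inr, edgeToK3, replaceVertex_inl_inr]
    split_ifs with hi <;> simp only [Sum.inl.injEq, Subtype.mk.injEq] <;> grind
  · intro i j
    simp only [restGraph_adj, ho_inr, Ne, edgeToK3, replaceVertex_inr_inr]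
    refine and_iff_left ⟨?_, ?_⟩ <;> split_ifs <;> simp

/-- Splitting a vertex along an edge `uv` not of the form `x o(x)`. -/
theorem exists_orientation_edgeToK3_of_ne (huv : G.Adj u v) (h1 : ∀ x, G.Adj x (o x))
    (h2 : ∀ x, o (o x) ≠ x) (hu : o u ≠ v) (hv : o v ≠ u) :
    ∃ o', (∀ x, (edgeToK3 G u v φ).Adj x (o' x)) ∧ (∀ x, o' (o' x) ≠ x) ∧
      (∀ a b, (restGraph (edgeToK3 G u v φ) o').Adj (Sum.inl a) (Sum.inl b) ↔
        (restGraph G o).Adj a b) ∧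
      (∀ a i, (restGraph (edgeToK3 G u v φ) o').Adj (Sum.inl a) (Sum.inr i) ↔
        a = u ∨ (restGraph G o).Adj a v ∧ φ a = i) ∧
      ∀ i j, ¬ (restGraph (edgeToK3 G u v φ) o').Adj (Sum.inr i) (Sum.inr j) := by
  have hov : o v ≠ v := (h1 v).ne'
  -- The vertex not inheriting the out-edge of v points to the one that does, so P gains the edge
  -- between the new vertices and both edges from u stay in the tree.
  let o' : {a : V // a ≠ v} ⊕ Fin 2 → {a : V // a ≠ v} ⊕ Fin 2 :=
    Sum.elim (fun a => replaced v (φ a) (o a))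
      fun i => if i = φ (o v) then Sum.inl ⟨o v, hov⟩ else Sum.inr (φ (o v))
  have ho_inl : ∀ a, o' (Sum.inl a) = replaced v (φ a) (o a) := fun _ => rfl
  have ho_inr : ∀ i, o' (Sum.inr i) =
    if i = φ (o v) then Sum.inl ⟨o v, hov⟩ else Sum.inr (φ (o v)) := fun _ => rfl
  have h2v := h2 v
  refine ⟨o', ?_, ?_, ?_, ?_, ?_⟩
  · rintro (⟨a, ha⟩ | i)
    · rw [ho_inl]
      by_cases hoa : o a = v
      · rw [hoa, replaced_self]
        exact Or.inr ⟨hoa ▸ h1 a, rfl⟩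
      · rw [replaced_of_ne hoa]
        exact h1 a
    · rw [ho_inr]
      split_ifs with hi
      · exact Or.inr ⟨(h1 v).symm, hi.symm⟩
      · exact hi
  · rintro (⟨a, ha⟩ | i)
    · have h2a := h2 a
      rw [ho_inl]
      by_cases hoa : o a = v
      · simp only [hoa, replaced_self]
        rw [ho_inr]
        rw [hoa] at h2a
        split_ifs with hi
        · simpa using h2a
        · simp
      · rw [replaced_of_ne hoa, ho_inl, Ne, replaced_eq_inl]
        exact h2a
    · rw [ho_inr]
      split_ifs with hi
      · rw [ho_inl, Ne, replaced_eq_inr]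
        exact fun h => h2v h.1
      · rw [ho_inr, if_pos rfl]
        simp
  · intro a b
    simp only [restGraph_adj, ho_inl, Ne, replaced_eq_inl, edgeToK3, replaceVertex_inl_inl]
  · rintro ⟨a, ha⟩ i
    simp only [restGraph_adj, ho_inl, ho_inr, Ne, replaced_eq_inr, edgeToK3, replaceVertex_inl_inr]
    split_ifs with hi <;> grind
  · intro i j
    simp only [restGraph_adj, ho_inr, Ne, edgeToK3, replaceVertex_inr_inr]
    split_ifs <;> simp <;> grind

theorem HasOrientedDecomposition.edgeToK3 (h : HasOrientedDecomposition G) (huv : G.Adj u v)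
    (φ : V → Fin 2) : HasOrientedDecomposition (edgeToK3 G u v φ) := by
  classical
  obtain ⟨o, t, r, h1, h2, h3, h4⟩ := h
  have hne : Nonempty ({a : V // a ≠ v} ⊕ Fin 2) := ⟨Sum.inr 0⟩
  have huv' : u ≠ v := huv.ne
  by_cases hP : o v = u ∨ o u = v
  · -- the edge `uv` is one of the edges `x o(x)`
    wlog hφ : o v = u ∨ o u = v ∧ φ u = φ (o v) generalizing φ
    · rw [edgeToK3_congr (φ' := Function.update φ u (φ (o v)))
        (fun a ha => by rw [Function.update_of_ne ha])]
      refine this _ ?_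
      rcases hP with h | h
      · exact Or.inl h
      · refine Or.inr ⟨h, ?_⟩
        rw [Function.update_self]
        by_cases hvu : o v = u
        · rw [hvu, Function.update_self]
        · rw [Function.update_of_ne hvu]
    obtain ⟨o', ho1, ho2, hll, hlr, hrr⟩ := exists_orientation_edgeToK3_of_eq huv h1 h2 hφ
    let t' : {a : V // a ≠ v} ⊕ Fin 2 → {a : V // a ≠ v} ⊕ Fin 2 :=
      Sum.elim (fun a => replaced v (φ a) (t a))
        fun i => if i = φ (t v) then replaced v 0 (t v) else Sum.inr (φ (t v))
    have ht_inl : ∀ a, t' (Sum.inl a) = replaced v (φ a) (t a) := fun _ => rfl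
    have ht_inr : ∀ i, t' (Sum.inr i) =
      if i = φ (t v) then replaced v 0 (t v) else Sum.inr (φ (t v)) := fun _ => rfl
    refine ⟨o', t', replaced v (φ (t v)) r, ho1, ho2, ?_, ?_⟩
    · refine connected_of_fibers (Sum.elim Subtype.val fun _ => v) h3 ?_ ?_
      · rintro (⟨a, ha⟩ | i) (⟨b, hb⟩ | j) h
        · obtain rfl : a = b := h
          rfl
        · exact absurd h ha
        · exact absurd h.symm hb
        · by_cases hij : i = j
          · rw [hij]
          · exact ((hrr i j).2 hij).reachable
      · intro a b hab
        by_cases ha : a = v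
        · subst ha
          exact ⟨Sum.inr (φ b), Sum.inl ⟨b, hab.ne'⟩, rfl, rfl, ((hlr _ _).2 ⟨hab.symm, rfl⟩).symm⟩
        · by_cases hb : b = v
          · subst hb
            exact ⟨Sum.inl ⟨a, ha⟩, Sum.inr (φ a), rfl, rfl, (hlr _ _).2 ⟨hab, rfl⟩⟩
          · exact ⟨Sum.inl ⟨a, ha⟩, Sum.inl ⟨b, hb⟩, rfl, rfl, (hll _ _).2 hab⟩
    · have hmix : ∀ a i, (restGraph (TightGraph.edgeToK3 G u v φ) o').Adj (Sum.inl a) (Sum.inr i) →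
          (Sum.inl a ≠ replaced v (φ (t v)) r ∧ t' (Sum.inl a) = Sum.inr i) ∨
          (Sum.inr i ≠ replaced v (φ (t v)) r ∧ t' (Sum.inr i) = Sum.inl a) := by
        intro a i h
        obtain ⟨h, hφ'⟩ := (hlr a i).1 h
        simp only [Ne, inl_eq_replaced, inr_eq_replaced]
        rcases h4 a v h with ⟨h, h'⟩ | ⟨h, h'⟩
        · exact Or.inl ⟨Ne.symm h, by rw [ht_inl, h', replaced_self, hφ']⟩
        · refine Or.inr ⟨fun hr => h hr.1.symm, ?_⟩
          rw [ht_inr, if_pos (by rw [h', hφ']), replaced_eq_inl]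
          exact h'
      rintro (a | i) (b | j) h
      · have := h4 a b ((hll a b).1 h)
        simp only [Ne, inl_eq_replaced, ht_inl, replaced_eq_inl]
        rw [eq_comm (a := r), eq_comm (a := r)]
        exact this
      · exact hmix a j h
      · exact (hmix b i h.symm).symm
      · have hij := (hrr i j).1 h
        simp only [Ne, inr_eq_replaced, ht_inr]
        by_cases hi : i = φ (t v)
        · right
          have hj : j ≠ φ (t v) := fun h => hij (hi.trans h.symm)
          rw [if_neg hj, hi]
          exact ⟨fun h => hj h.2.symm, rfl⟩
        · left
          have hj : j = φ (t v) := by omega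
          rw [if_neg hi, hj]
          exact ⟨fun h => hi h.2.symm, rfl⟩
  · -- the edge `uv` is one of the remaining edges
    rw [not_or] at hP
    wlog hφ : (v ≠ r ∧ t v = u) ∨ (u ≠ r ∧ t u = v ∧ φ u = φ (t v)) generalizing φ
    · rw [edgeToK3_congr (φ' := Function.update φ u (φ (t v)))
        (fun a ha => by rw [Function.update_of_ne ha])]
      refine this _ ?_
      rcases h4 u v ⟨huv, hP.2, hP.1⟩ with h | h
      · refine Or.inr ⟨h.1, h.2, ?_⟩
        rw [Function.update_self]
        by_cases hvu : t v = u
        · rw [hvu, Function.update_self]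
        · rw [Function.update_of_ne hvu]
      · exact Or.inl h
    obtain ⟨o', ho1, ho2, hll, hlr, hrr⟩ :=
      exists_orientation_edgeToK3_of_ne (φ := φ) huv h1 h2 hP.2 hP.1
    -- One new vertex inherits the parent of v and the other hangs from u. If v was the parent of u,
    -- then φ u = φ (t v) makes the inheriting vertex the new parent of u, so both edges from u are
    -- covered.
    let t' : {a : V // a ≠ v} ⊕ Fin 2 → {a : V // a ≠ v} ⊕ Fin 2 :=
      Sum.elim (fun a => replaced v (φ a) (t a))
        fun i => if i = φ (t v) then replaced v 0 (t v) else Sum.inl ⟨u, huv'⟩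
    have ht_inl : ∀ a, t' (Sum.inl a) = replaced v (φ a) (t a) := fun _ => rfl
    have ht_inr : ∀ i, t' (Sum.inr i) =
      if i = φ (t v) then replaced v 0 (t v) else Sum.inl ⟨u, huv'⟩ := fun _ => rfl
    refine ⟨o', t', replaced v (φ (t v)) r, ho1, ho2, ?_, ?_⟩
    · refine connected_of_fibers (Sum.elim Subtype.val fun _ => v) h3 ?_ ?_
      · have hu : ∀ i, (restGraph (TightGraph.edgeToK3 G u v φ) o').Reachable
            (Sum.inl ⟨u, huv'⟩) (Sum.inr i) := fun i => ((hlr _ i).2 (Or.inl rfl)).reachable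
        rintro (⟨a, ha⟩ | i) (⟨b, hb⟩ | j) h
        · obtain rfl : a = b := h
          rfl
        · exact absurd h ha
        · exact absurd h.symm hb
        · exact (hu i).symm.trans (hu j)
      · intro a b hab
        by_cases ha : a = v
        · subst ha
          exact ⟨Sum.inr (φ b), Sum.inl ⟨b, hab.ne'⟩, rfl, rfl,
            ((hlr _ _).2 (Or.inr ⟨hab.symm, rfl⟩)).symm⟩
        · by_cases hb : b = v
          · subst hb
            exact ⟨Sum.inl ⟨a, ha⟩, Sum.inr (φ a), rfl, rfl, (hlr _ _).2 (Or.inr ⟨hab, rfl⟩)⟩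
          · exact ⟨Sum.inl ⟨a, ha⟩, Sum.inl ⟨b, hb⟩, rfl, rfl, (hll _ _).2 hab⟩
    · have hmix : ∀ a i, (restGraph (TightGraph.edgeToK3 G u v φ) o').Adj (Sum.inl a) (Sum.inr i) →
          (Sum.inl a ≠ replaced v (φ (t v)) r ∧ t' (Sum.inl a) = Sum.inr i) ∨
          (Sum.inr i ≠ replaced v (φ (t v)) r ∧ t' (Sum.inr i) = Sum.inl a) := by
        rintro ⟨a, ha⟩ i h
        simp only [Ne, inl_eq_replaced, inr_eq_replaced]
        rcases (hlr ⟨a, ha⟩ i).1 h with h | ⟨h, hφ'⟩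
        · simp only at h
          subst h
          by_cases hi : i = φ (t v)
          · rcases hφ with ⟨h, h'⟩ | ⟨h, h', h''⟩
            · refine Or.inr ⟨fun hr => h hr.1.symm, ?_⟩
              rw [ht_inr, if_pos hi, replaced_eq_inl]
              exact h'
            · exact Or.inl ⟨Ne.symm h, by rw [ht_inl, h', replaced_self, h'', hi]⟩
          · refine Or.inr ⟨fun hr => hi hr.2.symm, ?_⟩
            rw [ht_inr, if_neg hi]
        · rcases h4 a v h with ⟨h, h'⟩ | ⟨h, h'⟩
          · exact Or.inl ⟨Ne.symm h, by rw [ht_inl, h', replaced_self, ← hφ']⟩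
          · refine Or.inr ⟨fun hr => h hr.1.symm, ?_⟩
            rw [ht_inr, if_pos (by rw [h', ← hφ']), replaced_eq_inl]
            exact h'
      rintro (a | i) (b | j) h
      · have := h4 a b ((hll a b).1 h)
        simp only [Ne, inl_eq_replaced, ht_inl, replaced_eq_inl]
        rw [eq_comm (a := r), eq_comm (a := r)]
        exact this
      · exact hmix a j h
      · exact (hmix b i h.symm).symm
      · exact absurd h (hrr i j)

theorem Derivable.hasOrientedDecomposition (h : Derivable G) : HasOrientedDecomposition G := by
  induction h with
  | base_K5MinusEdge G e => exact hasOrientedDecomposition_K5MinusEdge.of_iso e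
  | base_twoK4 G e => exact hasOrientedDecomposition_twoK4.of_iso e
  | iso G G' e _ ih => exact ih.of_iso e
  | henneberg1 G a b hab _ ih => exact ih.henneberg1 hab
  | henneberg2 G a b c hab hca hcb _ ih => exact ih.henneberg2 hab hca hcb
  | vertexToK4 G v φ _ ih => exact ih.vertexToK4 v φ
  | edgeToK3 G u v huv φ _ ih => exact ih.edgeToK3 huv φ
  | edgeJoin K H u v _ _ ihK ihH => exact ihK.edgeJoin ihH u v

end EdgeToK3

/-! ### Unicyclic components as functional graphs, and the final count -/

section Unicyclic

open SimpleGraph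

variable {V : Type u} {P : SimpleGraph V}

/-- The edges of a cycle cannot be assigned injectively to its vertices other than a given one. -/
theorem not_isCycle_of_cover {v y : V} (p : P.Walk v v) (hp : p.IsCycle) (hy : y ∈ p.support)
    (t : V → V) (ht : ∀ a b, s(a, b) ∈ p.edges → (a ≠ y ∧ t a = b) ∨ (b ≠ y ∧ t b = a)) : False := by
  classical
  have hsub : p.edges.toFinset ⊆ (p.support.tail.toFinset.erase y).image fun z => s(z, t z) := by
    have hmem : ∀ z ∈ p.support, z ∈ p.support.tail := by
      intro z hz
      rw [Walk.mem_support_iff] at hz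
      rcases hz with rfl | hz
      · exact p.end_mem_tail_support hp.not_nil
      · exact hz
    intro e he
    induction e with | _ a b
    rw [List.mem_toFinset] at he
    simp only [Finset.mem_image, Finset.mem_erase, List.mem_toFinset]
    rcases ht a b he with ⟨h, h'⟩ | ⟨h, h'⟩
    · exact ⟨a, ⟨h, hmem a (p.fst_mem_support_of_mem_edges he)⟩, by rw [h']⟩
    · exact ⟨b, ⟨h, hmem b (p.snd_mem_support_of_mem_edges he)⟩, by rw [h', Sym2.eq_swap]⟩
  have hy' : y ∈ p.support.tail.toFinset := by
    rw [List.mem_toFinset]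
    rw [Walk.mem_support_iff] at hy
    rcases hy with rfl | hy
    · exact p.end_mem_tail_support hp.not_nil
    · exact hy
  have h1 := (Finset.card_le_card hsub).trans Finset.card_image_le
  rw [Finset.card_erase_of_mem hy', List.toFinset_card_of_nodup hp.support_nodup,
    List.toFinset_card_of_nodup hp.isTrail.edges_nodup, Walk.length_edges, List.length_tail,
    Walk.length_support] at h1
  have := hp.three_le_length
  omega

theorem reachable_deleteEdges_of_reachable {a b x y : V}
    (h : (P.deleteEdges {s(a, b)}).Reachable a b) (hxy : P.Reachable x y) :
    (P.deleteEdges {s(a, b)}).Reachable x y := by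
  obtain ⟨p⟩ := hxy
  induction p with
  | nil => rfl
  | @cons x z y hxz p ih =>
    refine Reachable.trans ?_ ih
    by_cases he : s(x, z) = s(a, b)
    · rcases Sym2.eq_iff.1 he with ⟨rfl, rfl⟩ | ⟨rfl, rfl⟩
      exacts [h, h.symm]
    · exact Adj.reachable (by simpa [deleteEdges_adj, hxz] using he)

/-- The graph with edges `x o(x)`. -/
def functionalGraph (o : V → V) : SimpleGraph V := SimpleGraph.fromRel fun a b => o a = b

variable {o : V → V}

theorem functionalGraph_adj (h : ∀ x, o x ≠ x) {a b : V} :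
    (functionalGraph o).Adj a b ↔ o a = b ∨ o b = a := by
  simp only [functionalGraph, fromRel_adj]
  refine and_iff_right_of_imp ?_
  rintro (rfl | rfl)
  exacts [(h _).symm, h _]

/-- Iterating `o` from x reaches a periodic point y. Its orbit returns from `o y` to y without the
edge between them, so that edge lies on a cycle. -/
theorem exists_isCycle_functionalGraph [Finite V] (h1 : ∀ x, o x ≠ x) (h2 : ∀ x, o (o x) ≠ x)
    (x : V) : ∃ (v : V) (p : (functionalGraph o).Walk v v), p.IsCycle ∧
      ∀ y ∈ p.support, (functionalGraph o).Reachable x y := by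
  classical
  have hadj : ∀ z, (functionalGraph o).Adj z (o z) := fun z =>
    (functionalGraph_adj h1).2 (Or.inl rfl)
  have hreach : ∀ n z, (functionalGraph o).Reachable z (o^[n] z) := by
    intro n
    induction n with
    | zero => exact fun z => Reachable.refl _
    | succ n ih => exact fun z => (hadj z).reachable.trans (ih (o z))
  obtain ⟨y, hxy, m, hm, hym⟩ : ∃ y, (functionalGraph o).Reachable x y ∧ ∃ m, 0 < m ∧
      o^[m] y = y := by
    obtain ⟨i, j, hij, h⟩ := Finite.exists_ne_map_eq_of_infinite fun n : ℕ => o^[n] x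
    wlog hlt : i < j generalizing i j
    · exact this j i hij.symm h.symm (by omega)
    refine ⟨o^[i] x, hreach i x, j - i, by omega, ?_⟩
    rw [← Function.iterate_add_apply, Nat.sub_add_cancel hlt.le]
    exact h.symm
  have hper : y ∈ Function.periodicPts o := ⟨m, hm, hym⟩
  have hpos := Function.minimalPeriod_pos_of_mem_periodicPts hper
  have key : ∀ n, n + 1 ≤ Function.minimalPeriod o y →
      ((functionalGraph o).deleteEdges {s(y, o y)}).Reachable (o y) (o^[n + 1] y) := by
    intro n
    induction n with
    | zero => exact fun _ => Reachable.refl _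
    | succ n ih =>
      intro hn
      refine (ih (by omega)).trans (Adj.reachable ?_)
      rw [Function.iterate_succ_apply' o (n + 1)]
      -- The next step could use the deleted edge only from y, which the minimal period excludes, or
      -- backwards from `o y` to y, which `h2` excludes.
      have hne : o^[n + 1] y ≠ y := fun h =>
        Function.not_isPeriodicPt_of_pos_of_lt_minimalPeriod (Nat.succ_ne_zero n) (by omega) h
      simp only [deleteEdges_adj, hadj, Set.mem_singleton_iff, Sym2.eq_iff, true_and, hne,
        false_and, false_or, not_and]
      intro h
      rw [h]
      exact h2 y
  obtain ⟨k, hk⟩ := Nat.exists_eq_succ_of_ne_zero hpos.ne'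
  have hk' := key k (by omega)
  rw [← Nat.succ_eq_add_one, ← hk, Function.iterate_minimalPeriod] at hk'
  obtain ⟨v, p, hp, he⟩ := adj_and_reachable_delete_edges_iff_exists_cycle.1
    ⟨hadj y, hk'.symm⟩
  refine ⟨v, p, hp, fun z hz => hxy.trans ?_⟩
  exact (Reachable.symm ⟨p.takeUntil y (p.fst_mem_support_of_mem_edges he)⟩).trans
    ⟨p.takeUntil z hz⟩

/-- Suppose p uses an edge from x to `o x` that q avoids. Deleting it keeps the component connected
and leaves x owning no edge. Rerooting from x to the start w of q assigns the edges of q to vertices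
other than w, one too few for a cycle. -/
theorem edges_subset_of_isCycle_functionalGraph (h1 : ∀ x, o x ≠ x)
    {v w : V} {p : (functionalGraph o).Walk v v} {q : (functionalGraph o).Walk w w}
    (hp : p.IsCycle) (hq : q.IsCycle) (hvw : (functionalGraph o).Reachable v w) :
    p.edges ⊆ q.edges := by
  classical
  intro e hep
  by_contra heq
  have hE := p.edges_subset_edgeSet hep
  obtain ⟨x, rfl⟩ : ∃ x, e = s(x, o x) := by
    induction e with | _ a b
    rcases (functionalGraph_adj h1).1 (mem_edgeSet _ |>.1 hE) with h | h
    exacts [⟨a, by rw [h]⟩, ⟨b, by rw [h, Sym2.eq_swap]⟩]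
  have hdel := (adj_and_reachable_delete_edges_iff_exists_cycle.2 ⟨v, p, hp, hep⟩).2
  have hxv : (functionalGraph o).Reachable x v :=
    Reachable.symm ⟨p.takeUntil x (p.fst_mem_support_of_mem_edges hep)⟩
  obtain ⟨r⟩ := reachable_deleteEdges_of_reachable hdel (hxv.trans hvw)
  obtain ⟨t, ht⟩ := exists_reroot r o (by
    intro a b hab
    rw [deleteEdges_adj, functionalGraph_adj h1, Set.mem_singleton_iff] at hab
    obtain ⟨rfl | rfl, hne⟩ := hab
    · exact Or.inl ⟨by rintro rfl; exact hne rfl, rfl⟩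
    · exact Or.inr ⟨by rintro rfl; exact hne Sym2.eq_swap, rfl⟩)
  refine not_isCycle_of_cover q hq q.start_mem_support t fun a b hab => ht a b ?_
  rw [deleteEdges_adj]
  exact ⟨q.edges_subset_edgeSet hab, fun h => heq (h ▸ hab)⟩

theorem componentsUnicyclic_functionalGraph [Finite V] (h1 : ∀ x, o x ≠ x)
    (h2 : ∀ x, o (o x) ≠ x) : ComponentsUnicyclic (functionalGraph o) := by
  intro c
  induction c using ConnectedComponent.ind with | _ x
  obtain ⟨v, p, hp, hpx⟩ := exists_isCycle_functionalGraph h1 h2 x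
  refine ⟨p.toSubgraph, ⟨⟨v, p, hp, rfl⟩, ?_⟩, ?_⟩
  · intro y hy
    rw [ConnectedComponent.mem_supp_iff]
    exact ConnectedComponent.sound (hpx y ((p.mem_verts_toSubgraph).1 hy)).symm
  · rintro _ ⟨⟨w, q, hq, rfl⟩, hqx⟩
    have hw := hqx q.start_mem_verts_toSubgraph
    rw [ConnectedComponent.mem_supp_iff, ConnectedComponent.eq] at hw
    have hwv : (functionalGraph o).Reachable w v := hw.trans (hpx v p.start_mem_support)
    apply le_antisymm
    · rw [Walk.toSubgraph_le_iff hq.not_nil, Walk.edgeSet_toSubgraph]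
      exact fun e he => edges_subset_of_isCycle_functionalGraph h1 hq hp hwv he
    · rw [Walk.toSubgraph_le_iff hp.not_nil, Walk.edgeSet_toSubgraph]
      exact fun e he => edges_subset_of_isCycle_functionalGraph h1 hp hq hwv.symm he

theorem HasOrientedDecomposition.hasTreeUnicyclicDecomposition [Finite V] {G : SimpleGraph V}
    (h : HasOrientedDecomposition G) : HasTreeUnicyclicDecomposition G := by
  classical
  obtain ⟨o, t, r, h1, h2, h3, h4⟩ := h
  have h1' : ∀ x, o x ≠ x := fun x => (h1 x).ne'
  refine ⟨restGraph G o, functionalGraph o, ?_, ?_, ?_, componentsUnicyclic_functionalGraph h1' h2⟩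
  · ext a b
    rw [sup_adj, restGraph_adj, functionalGraph_adj h1']
    constructor
    · rintro (h | rfl | rfl)
      exacts [h.1, h1 _, (h1 _).symm]
    · tauto
  · rw [Set.disjoint_left]
    intro e
    induction e with | _ a b
    rw [mem_edgeSet, mem_edgeSet, restGraph_adj, functionalGraph_adj h1']
    tauto
  · rw [isTree_iff_connected_and_card]
    -- Every tree edge is owned by a vertex other than r, so there are at most |V| - 1 of them.
    refine ⟨h3, le_antisymm ?_ h3.card_vert_le_card_edgeSet_add_one⟩
    have : Fintype V := Fintype.ofFinite V
    have hsub : (restGraph G o).edgeSet ⊆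
        ((Finset.univ.erase r).image fun z => s(z, t z) : Finset (Sym2 V)) := by
      intro e
      induction e with | _ a b
      intro hab
      simp only [Finset.coe_image, Finset.coe_erase, Finset.coe_univ, Set.mem_image, Set.mem_sdiff,
        Set.mem_univ, true_and, Set.mem_singleton_iff]
      rcases h4 a b hab with ⟨h, h'⟩ | ⟨h, h'⟩
      · exact ⟨a, h, by rw [h']⟩
      · exact ⟨b, h, by rw [h', Sym2.eq_swap]⟩
    have hle := Set.ncard_le_ncard hsub (Finset.finite_toSet _)
    rw [Set.ncard_coe_finset] at hle
    have hle' := hle.trans Finset.card_image_le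
    rw [Finset.card_erase_of_mem (Finset.mem_univ r), Finset.card_univ] at hle'
    rw [Nat.card_coe_set_eq, Nat.card_eq_fintype_card]
    have : 0 < Fintype.card V := Fintype.card_pos_iff.2 ⟨r⟩
    omega

/-- A forest with a root in each component can be oriented towards the roots. -/
theorem exists_orientation_of_isAcyclic {F : SimpleGraph V} (hF : F.IsAcyclic) (ρ : V → V)
    (hρ : ∀ x, F.Reachable x (ρ x)) (hρ' : ∀ x y, F.Adj x y → ρ x = ρ y) :
    ∃ o : V → V, (∀ a, a ≠ ρ a → F.Adj a (o a)) ∧ (∀ a, a ≠ ρ a → o (o a) ≠ a) ∧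
      ∀ a b, F.Adj a b → (a ≠ ρ a ∧ o a = b) ∨ (b ≠ ρ b ∧ o b = a) := by
  classical
  choose q hq using fun x => (hρ x).exists_isPath
  have hsnd : ∀ x r, ρ x = r → ∀ p : F.Walk x r, p.IsPath → (q x).snd = p.snd := by
    rintro x _ rfl p hp
    have := (hF.subsingleton_path x (ρ x)).elim ⟨q x, hq x⟩ ⟨p, hp⟩
    rw [Subtype.mk.inj this]
  have hroot : ∀ x, x ≠ ρ x → ¬ (q x).Nil := fun x hx => Walk.not_nil_of_ne hx
  refine ⟨fun x => (q x).snd, fun a ha => Walk.adj_snd (hroot a ha), fun a ha => ?_,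
    fun a b hab => ?_⟩
  · obtain ⟨b, h, p, hp⟩ := Walk.not_nil_iff.1 (hroot a ha)
    have hpath := hq a
    rw [hp, Walk.cons_isPath_iff] at hpath
    have hb : (q a).snd = b := by rw [hp, Walk.snd_cons]
    change (q (q a).snd).snd ≠ a
    rw [hb, hsnd b (ρ a) (hρ' a b h).symm p hpath.1]
    intro h'
    have hm : p.snd ∈ p.support := p.getVert_mem_support 1
    rw [h'] at hm
    exact hpath.2 hm
  -- If b lies on the root path of a, acyclicity makes it the second vertex; if not, prepending b
  -- yields the root path of b.
  · by_cases hb : b ∈ (q a).support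
    · left
      refine ⟨fun ha => ?_, (hF.eq_snd_of_adj_start (hq a) hab hb).symm⟩
      have : (q a).Nil := by
        have h1 := hq a
        generalize q a = p at h1
        revert p
        rw [← ha]
        intro p hp
        exact Walk.isPath_iff_nil.1 hp
      rw [Walk.nil_iff_support_eq.1 this] at hb
      exact hab.ne' (List.mem_singleton.1 hb)
    · right
      have hpath : (Walk.cons hab.symm (q a)).IsPath := (Walk.cons_isPath_iff _ _).2 ⟨hq a, hb⟩
      refine ⟨fun h => hb ?_, ?_⟩
      · rw [h, ← hρ' a b hab]
        exact Walk.end_mem_support _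
      · exact (hsnd b (ρ a) (hρ' a b hab).symm _ hpath).trans (Walk.snd_cons _ _)

/-- This is the fundamental cycle of a chord. The chord is its only edge outside F, so different
chords give different cycles. -/
theorem isCycle_cons_of_forest {F : SimpleGraph V} (hFP : F ≤ P) {a b : V} (hab : P.Adj a b)
    (hnF : ¬ F.Adj a b) (hr : F.Reachable b a) :
    ∃ p : P.Walk a a, p.IsCycle ∧ s(a, b) ∈ p.edges ∧ ∀ e ∈ p.edges, e = s(a, b) ∨ e ∈ F.edgeSet := by
  obtain ⟨q, hq⟩ := hr.exists_isPath
  refine ⟨Walk.cons hab (q.mapLe hFP), ?_, by simp, ?_⟩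
  · rw [Walk.cons_isCycle_iff]
    refine ⟨(Walk.isPath_mapLe hFP).2 hq, ?_⟩
    rw [Walk.edges_mapLe_eq_edges]
    exact fun h => hnF (q.edges_subset_edgeSet h)
  · intro e he
    rw [Walk.edges_cons, List.mem_cons, Walk.edges_mapLe_eq_edges] at he
    exact he.imp id fun h => q.edges_subset_edgeSet h

/-- A graph with unicyclic components can be oriented with all out-degrees equal to one. -/
theorem ComponentsUnicyclic.exists_orientation (hP : ComponentsUnicyclic P) :
    ∃ o : V → V, (∀ a, P.Adj a (o a)) ∧ (∀ a, o (o a) ≠ a) ∧ ∀ a b, P.Adj a b → o a = b ∨ o b = a := by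
  classical
  obtain ⟨F, hFP, hF, hreach⟩ := P.exists_isAcyclic_reachable_eq_le
  -- The cycle of a component cannot lie in the spanning forest, so each component has a chord αβ;
  -- by `huniq` it is the only one.
  have hex : ∀ c : P.ConnectedComponent, ∃ a b, P.Adj a b ∧ ¬ F.Adj a b ∧
      P.connectedComponentMk a = c := by
    intro c
    obtain ⟨_, ⟨⟨v, p, hp, rfl⟩, hc⟩, -⟩ := hP c
    by_contra! hcon
    have hpF : ∀ e ∈ p.edges, e ∈ F.edgeSet := by
      intro e he
      induction e with | _ a b
      by_contra hnF
      refine hcon a b (p.edges_subset_edgeSet he) hnF ?_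
      exact hc ((p.mem_verts_toSubgraph).2 (p.fst_mem_support_of_mem_edges he))
    exact hF (p.transfer F hpF) (hp.transfer hpF)
  choose α β hα hβ hcomp using hex
  have huniq : ∀ a b, P.Adj a b → ¬ F.Adj a b →
      s(a, b) = s(α (P.connectedComponentMk a), β (P.connectedComponentMk a)) := by
    intro a b hab hnF
    set c := P.connectedComponentMk a with hc
    obtain ⟨p, hp, hpe, hpF⟩ := isCycle_cons_of_forest hFP hab hnF (hreach ▸ hab.symm.reachable)
    obtain ⟨q, hq, hqe, hqF⟩ := isCycle_cons_of_forest hFP (hα c) (hβ c)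
      (hreach ▸ (hα c).symm.reachable)
    have hsupp : ∀ {v : V} (w : P.Walk v v), P.connectedComponentMk v = c →
        w.toSubgraph.verts ⊆ c.supp := by
      intro v w hv y hy
      rw [ConnectedComponent.mem_supp_iff, ← hv]
      exact ConnectedComponent.sound
        (Reachable.symm ⟨w.takeUntil y (w.mem_verts_toSubgraph.1 hy)⟩)
    have heq := (hP c).unique ⟨⟨_, p, hp, rfl⟩, hsupp p hc.symm⟩ ⟨⟨_, q, hq, rfl⟩, hsupp q (hcomp c)⟩
    have : s(a, b) ∈ q.edges := by
      rw [← Walk.mem_edges_toSubgraph, ← heq, Walk.mem_edges_toSubgraph]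
      exact hpe
    rcases hqF _ this with h | h
    · exact h
    · exact absurd h hnF
  have hρ : ∀ x, F.Reachable x (α (P.connectedComponentMk x)) := by
    intro x
    rw [hreach]
    exact ConnectedComponent.exact (hcomp _).symm
  obtain ⟨o, ho1, ho2, ho3⟩ := exists_orientation_of_isAcyclic hF
    (fun x => α (P.connectedComponentMk x)) hρ (fun x y h => by
      rw [ConnectedComponent.sound (hFP h).reachable])
  -- The forest is directed towards the roots α, and each root, which has no forest out-edge, takes
  -- the chord to β.
  obtain ⟨o', hpos, hneg⟩ : ∃ o' : V → V,
      (∀ x, x = α (P.connectedComponentMk x) → o' x = β (P.connectedComponentMk x)) ∧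
      ∀ x, x ≠ α (P.connectedComponentMk x) → o' x = o x :=
    ⟨fun x => if x = α (P.connectedComponentMk x) then β (P.connectedComponentMk x) else o x,
      fun x hx => if_pos hx, fun x hx => if_neg hx⟩
  refine ⟨o', ?_, ?_, ?_⟩
  · intro a
    by_cases ha : a = α (P.connectedComponentMk a)
    · have := hα (P.connectedComponentMk a)
      rwa [← ha, ← hpos a ha] at this
    · rw [hneg a ha]
      exact hFP (ho1 a ha)
  · intro a
    by_cases ha : a = α (P.connectedComponentMk a)
    · have hadj := hα (P.connectedComponentMk a)
      have hnF := hβ (P.connectedComponentMk a)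
      rw [← ha] at hadj hnF
      rw [hpos a ha]
      have hcb : P.connectedComponentMk (β (P.connectedComponentMk a)) = P.connectedComponentMk a :=
        ConnectedComponent.sound hadj.symm.reachable
      have hbα : β (P.connectedComponentMk a) ≠
          α (P.connectedComponentMk (β (P.connectedComponentMk a))) := by
        rw [hcb, ← ha]
        exact hadj.ne'
      rw [hneg _ hbα]
      intro h
      have := ho1 _ hbα
      rw [h] at this
      exact hnF this.symm
    · rw [hneg a ha]
      have hadj := ho1 a ha
      by_cases hb : o a = α (P.connectedComponentMk (o a))
      · rw [hpos _ hb]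
        intro h
        have hnF := hβ (P.connectedComponentMk (o a))
        rw [← hb, h] at hnF
        exact hnF hadj.symm
      · rw [hneg _ hb]
        exact ho2 a ha
  · intro a b hab
    by_cases hFab : F.Adj a b
    · rcases ho3 a b hFab with ⟨h, h'⟩ | ⟨h, h'⟩
      · exact Or.inl ((hneg a h).trans h')
      · exact Or.inr ((hneg b h).trans h')
    · have hcb : P.connectedComponentMk b = P.connectedComponentMk a :=
        ConnectedComponent.sound hab.symm.reachable
      rcases Sym2.eq_iff.1 (huniq a b hab hFab) with ⟨h, h'⟩ | ⟨h, h'⟩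
      · exact Or.inl ((hpos a h).trans h'.symm)
      · right
        rw [hpos b (by rw [hcb]; exact h'), hcb]
        exact h.symm

open Finset in
-- An edge of P inside S is owned by its tail in S, giving at most |S| edges. Rooting T at a vertex
-- of S leaves that vertex owning nothing, giving at most |S| - 1. On all of V both bounds are
-- attained.
theorem HasTreeUnicyclicDecomposition.isTight [Finite V] {G : SimpleGraph V}
    (h : HasTreeUnicyclicDecomposition G) : IsTight 1 G := by
  classical
  let : Fintype V := Fintype.ofFinite V
  obtain ⟨T, P, rfl, hdisj, hT, hP⟩ := h
  obtain ⟨o, ho1, ho2, ho3⟩ := hP.exists_orientation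
  have hcard : ∀ S, #(edgesIn (T ⊔ P) S) = #(edgesIn T S) + #(edgesIn P S) := by
    intro S
    rw [← card_union_of_disjoint]
    · congr 1
      ext e
      induction e with | _ a b
      simp only [mk_mem_edgesIn, mem_union, sup_adj]
      tauto
    · rw [Finset.disjoint_left]
      intro e h h'
      exact Set.disjoint_left.1 hdisj (mem_edgesIn.1 h).2 (mem_edgesIn.1 h').2
  have hPle : ∀ S, #(edgesIn P S) ≤ #S := by
    intro S
    refine (card_le_card (t := S.image fun z => s(z, o z)) ?_).trans card_image_le
    intro e
    induction e with | _ a b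
    rw [mk_mem_edgesIn, mem_image]
    rintro ⟨ha, hb, hab⟩
    rcases ho3 a b hab with h | h
    · exact ⟨a, ha, by rw [h]⟩
    · exact ⟨b, hb, by rw [h, Sym2.eq_swap]⟩
  have hPge : Fintype.card V ≤ #(edgesIn P univ) := by
    rw [← card_univ]
    refine card_le_card_of_injOn (fun z => s(z, o z)) ?_ ?_
    · intro z _
      simpa [mk_mem_edgesIn] using ho1 z
    · intro x _ y _ hxy
      rcases Sym2.eq_iff.1 hxy with ⟨h, -⟩ | ⟨h, h'⟩
      · exact h
      · exact absurd (by rw [h', ← h]) (ho2 x)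
  have hTle : ∀ S, S.Nonempty → #(edgesIn T S) + 1 ≤ #S := by
    rintro S ⟨r, hr⟩
    obtain ⟨t, -, -, ht⟩ := exists_orientation_of_isAcyclic hT.isAcyclic (fun _ => r)
      (fun x => hT.connected x r) (fun _ _ _ => rfl)
    have : #(edgesIn T S) ≤ #(S.erase r) := by
      refine (card_le_card (t := (S.erase r).image fun z => s(z, t z)) ?_).trans card_image_le
      intro e
      induction e with | _ a b
      rw [mk_mem_edgesIn, mem_image]
      rintro ⟨ha, hb, hab⟩
      rcases ht a b hab with ⟨h, h'⟩ | ⟨h, h'⟩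
      · exact ⟨a, mem_erase.2 ⟨h, ha⟩, by rw [h']⟩
      · exact ⟨b, mem_erase.2 ⟨h, hb⟩, by rw [h', Sym2.eq_swap]⟩
    rw [card_erase_of_mem hr] at this
    have := card_pos.2 ⟨r, hr⟩
    omega
  have hTge : Fintype.card V ≤ #(edgesIn T univ) + 1 := by
    have := hT.connected.card_vert_le_card_edgeSet_add_one
    have he : T.edgeSet = (edgesIn T univ : Set (Sym2 V)) := by
      ext e
      simp [mem_edgesIn]
    rwa [Nat.card_coe_set_eq, he, Set.ncard_coe_finset, Nat.card_eq_fintype_card] at this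
  rw [isTight_one_iff]
  refine ⟨fun S hS => ?_, ?_⟩
  · have h1 := hPle S
    have h2 := hTle S hS
    rw [frd, hcard]
    push_cast
    omega
  · have : Nonempty V := hT.connected.nonempty
    have h1 := hPle univ
    have h2 := hTle univ univ_nonempty
    rw [card_univ] at h1 h2
    rw [frd, hcard, card_univ]
    push_cast
    omega

end Unicyclic

end TightGraph

theorem theorem1p3 {V : Type u} [Finite V] (G : SimpleGraph V) :
    List.TFAE
      [TightGraph.IsTight 1 G,
        TightGraph.Derivable G,
        TightGraph.HasTreeUnicyclicDecomposition G] := by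
  tfae_have 1 → 2 := fun h => TightGraph.derivable_of_isTight h
  tfae_have 2 → 3 := fun h => h.hasOrientedDecomposition.hasTreeUnicyclicDecomposition
  tfae_have 3 → 1 := fun h => h.isTight
  tfae_finish
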